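/- Let $(M,g_M)$ and $(N,g_N)$ be smooth finite-dimensional Riemannian manifolds without boundary and $F:M\to N$ a smooth Riemannian map, i.e. $g_N(F_*X,F_*Y)=g_M(X,Y)$ for all $X,Y\in(\ker F_{*p})^\perp$, $p\in M$. Assume that $F$ is totally geodesic, i.e. its second fundamental form $(\nabla F_*)(X,Y)=\nabla^F_XF_*Y-F_*(\nabla^M_XY)$ vanishes, where $\nabla^F$ is the pullback to $F^{-1}TN$ of the Levi-Civita connection $\nabla^N$. Assume that $\mathrm{range}\,F_*$ is a subbundle of $TN$: there is a smooth distribution on $N$, again denoted $\mathrm{range}\,F_*$, whose fibre at $F(p)$ is $F_*(T_pM)$ for every $p\in M$; outside $\overline{F(M)}$, where $F$ does not determine it (no condition if $F(M)$ is dense in $N$), this distribution is assumed to be totally geodesic, i.e. $\nabla^N_XY\in\Gamma(\mathrm{range}\,F_*)$ for local sections $X,Y$ of $\mathrm{range}\,F_*$. Assume also that the orthogonal distribution $(\mathrm{range}\,F_*)^\perp$ is totally geodesic on $N$, i.e. $\nabla^N_UV\in\Gamma((\mathrm{range}\,F_*)^\perp)$ for all local sections $U,V$ of $(\mathrm{range}\,F_*)^\perp$.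 Let $(N,g_N,\xi,\lambda)$ be a Ricci soliton: $\xi$ is a smooth vector field on $N$, $\lambda\in\mathbb R$, and $\tfrac12(L_\xi g_N)(X,Y)+\mathrm{Ric}(X,Y)+\lambda g_N(X,Y)=0$ for all vector fields $X,Y$, where $\mathrm{Ric}(X,Y)=\mathrm{trace}(Z\mapsto R(Z,X)Y)$ and $R(X,Y)Z=\nabla_X\nabla_YZ-\nabla_Y\nabla_XZ-\nabla_{[X,Y]}Z$. Then: (i) If $\xi\in\Gamma(\mathrm{range}\,F_*)$, then every leaf of $\mathrm{range}\,F_*$, and more generally every immersed integral manifold $L$ of it, with the induced metric, is a Ricci soliton, with the constant $\lambda$ and with the restriction of $\xi$ to $L$ as potential field. (ii) If $\xi\in\Gamma((\mathrm{range}\,F_*)^\perp)$, then every leaf of $\mathrm{range}\,F_*$, and more generally every immersed integral manifold $L$ of it, with the induced metric, is Einstein: $\mathrm{Ric}^L=-\lambda g_L$. -/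

import Mathlib

open Bundle Set
open scoped Manifold ContDiff

noncomputable section

namespace RiemGeom

section Basic

variable {E : Type*} [NormedAddCommGroup E] [NormedSpace ℝ E]
  {M : Type*} [TopologicalSpace M] [ChartedSpace E M] [IsManifold 𝓘(ℝ, E) ∞ M]

/-- Vector fields on a manifold `M` modelled on `E` (no regularity built in). -/
abbrev VField (E : Type*) [NormedAddCommGroup E] [NormedSpace ℝ E]
    (M : Type*) [TopologicalSpace M] [ChartedSpace E M] :=
  (x : M) → TangentSpace 𝓘(ℝ, E) x

/-- Smooth Riemannian metrics on a manifold `M` modelled on `E`. -/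
abbrev Metric (E : Type*) [NormedAddCommGroup E] [NormedSpace ℝ E]
    (M : Type*) [TopologicalSpace M] [ChartedSpace E M] [IsManifold 𝓘(ℝ, E) ∞ M] :=
  ContMDiffRiemannianMetric 𝓘(ℝ, E) ∞ E (fun x : M => TangentSpace 𝓘(ℝ, E) x)

/-- The vector field `X` is smooth on the set `u`. -/
def SmoothFieldOn (X : VField E M) (u : Set M) : Prop :=
  ContMDiffOn 𝓘(ℝ, E) 𝓘(ℝ, E).tangent ∞ (fun x => (⟨x, X x⟩ : TangentBundle 𝓘(ℝ, E) M)) u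

/-- A vector field extending the tangent vector `v` at `x`, smooth near `x` (it has constant
components in the coordinates around `x`). -/
def extendVec {x : M} (v : TangentSpace 𝓘(ℝ, E) x) : VField E M :=
  FiberBundle.extend E (E := fun y : M => TangentSpace 𝓘(ℝ, E) y) v

/-- The derivative `X(f)` of a real function `f` along the vector field `X`. -/
def dirDeriv (X : VField E M) (f : M → ℝ) (x : M) : ℝ :=
  mvfderiv 𝓘(ℝ, E) f x (X x)

/-- The Lie bracket `[X, Y]` of vector fields. -/
def bracket (X Y : VField E M) : VField E M :=
  VectorField.mlieBracket 𝓘(ℝ, E) X Y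

variable (g : Metric E M)

/-- The function `g(X, Y)`. -/
def ip (X Y : VField E M) (x : M) : ℝ := g.inner x (X x) (Y x)

/-- The right-hand side of the Koszul formula,
`X g(Y,Z) + Y g(X,Z) - Z g(X,Y) + g([X,Y],Z) - g([X,Z],Y) - g([Y,Z],X)`. -/
def koszul (X Y Z : VField E M) (x : M) : ℝ :=
  dirDeriv X (ip g Y Z) x + dirDeriv Y (ip g X Z) x - dirDeriv Z (ip g X Y) x
    + ip g (bracket X Y) Z x - ip g (bracket X Z) Y x - ip g (bracket Y Z) X x

/-- The Levi-Civita covariant derivative `∇_X Y`, defined by the Koszul formula: its value at `x`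
is the tangent vector `a` with `2 g(a, w) = koszul X Y W` for all tangent vectors `w = W x`.
For `X`, `Y` differentiable at `x` there is exactly one such vector. -/
def covDeriv (X Y : VField E M) : VField E M := fun x =>
  Classical.epsilon fun a : TangentSpace 𝓘(ℝ, E) x =>
    ∀ w : TangentSpace 𝓘(ℝ, E) x, 2 * g.inner x a w = koszul g X Y (extendVec w) x

/-- The Riemannian curvature `R(X,Y)Z = ∇_X ∇_Y Z - ∇_Y ∇_X Z - ∇_[X,Y] Z`. -/
def curvature (X Y Z : VField E M) : VField E M := fun x =>
  covDeriv g X (covDeriv g Y Z) x - covDeriv g Y (covDeriv g X Z) x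
    - covDeriv g (bracket X Y) Z x

/-- The Ricci tensor `Ric(X,Y) = trace (Z ↦ R(Z,X)Y)`, the trace being computed in a basis of the
tangent space. -/
def ricci [FiniteDimensional ℝ E] (X Y : VField E M) (x : M) : ℝ :=
  haveI : FiniteDimensional ℝ (TangentSpace 𝓘(ℝ, E) x) := inferInstanceAs (FiniteDimensional ℝ E)
  let b := Module.finBasis ℝ (TangentSpace 𝓘(ℝ, E) x)
  ∑ i, b.repr (curvature g (extendVec (b i)) X Y x) i

/-- The Lie derivative of the metric, `(L_ξ g)(X,Y) = ξ g(X,Y) - g([ξ,X],Y) - g(X,[ξ,Y])`. -/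
def lieDerivMetric (ξ X Y : VField E M) (x : M) : ℝ :=
  dirDeriv ξ (ip g X Y) x - ip g (bracket ξ X) Y x - ip g X (bracket ξ Y) x

/-- `(M, g, ξ, lam)` is a Ricci soliton: `ξ` is a smooth vector field and
`(1/2) (L_ξ g)(X,Y) + Ric(X,Y) + lam g(X,Y) = 0` for all (locally defined) smooth `X`, `Y`. -/
def IsRicciSoliton [FiniteDimensional ℝ E] (ξ : VField E M) (lam : ℝ) : Prop :=
  SmoothFieldOn ξ univ ∧
    ∀ (u : Set M) (X Y : VField E M), IsOpen u → SmoothFieldOn X u → SmoothFieldOn Y u →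
      ∀ x ∈ u, (1 / 2 : ℝ) * lieDerivMetric g ξ X Y x + ricci g X Y x + lam * ip g X Y x = 0

/-- `(M, g)` is Einstein with Einstein constant `c`: `Ric = c g`. -/
def IsEinstein [FiniteDimensional ℝ E] (c : ℝ) : Prop :=
  ∀ (u : Set M) (X Y : VField E M), IsOpen u → SmoothFieldOn X u → SmoothFieldOn Y u →
    ∀ x ∈ u, ricci g X Y x = c * ip g X Y x

/-! ### Distributions -/

/-- A choice of a linear subspace of each tangent space. -/
abbrev PlaneField (E : Type*) [NormedAddCommGroup E] [NormedSpace ℝ E]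
    (M : Type*) [TopologicalSpace M] [ChartedSpace E M] :=
  (x : M) → Submodule ℝ (TangentSpace 𝓘(ℝ, E) x)

/-- `D` is a smooth distribution, i.e. a smooth subbundle of the tangent bundle: locally it has a
frame of smooth vector fields. -/
def IsSmoothDistribution (D : PlaneField E M) : Prop :=
  ∀ x : M, ∃ (u : Set M) (k : ℕ) (X : Fin k → VField E M), IsOpen u ∧ x ∈ u ∧
    (∀ i, SmoothFieldOn (X i) u) ∧
    ∀ y ∈ u, LinearIndependent ℝ (fun i => X i y) ∧
      Submodule.span ℝ (Set.range fun i => X i y) = D y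

/-- The orthogonal complement of a plane field. -/
def orthField (D : PlaneField E M) : PlaneField E M := fun x =>
  { carrier := {v | ∀ w ∈ D x, g.inner x v w = 0}
    add_mem' := by
      intro a b ha hb w hw
      simp [ha w hw, hb w hw]
    zero_mem' := by
      intro w _
      simp
    smul_mem' := by
      intro c a ha w hw
      simp [ha w hw] }

/-- The plane field `D` is totally geodesic on the open set `s`: for vector fields `X`, `Y` tangent
to `D` and defined on an open part of `s`, also `∇_X Y` is tangent to `D`. -/
def IsTotallyGeodesicOn (D : PlaneField E M) (s : Set M) : Prop :=
  ∀ (u : Set M) (X Y : VField E M), IsOpen u → u ⊆ s → SmoothFieldOn X u → SmoothFieldOn Y u →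
    (∀ x ∈ u, X x ∈ D x ∧ Y x ∈ D x) → ∀ x ∈ u, covDeriv g X Y x ∈ D x

end Basic

section Maps

variable {EM : Type*} [NormedAddCommGroup EM] [NormedSpace ℝ EM]
  {M : Type*} [TopologicalSpace M] [ChartedSpace EM M] [IsManifold 𝓘(ℝ, EM) ∞ M]
  {EN : Type*} [NormedAddCommGroup EN] [NormedSpace ℝ EN]
  {N : Type*} [TopologicalSpace N] [ChartedSpace EN N] [IsManifold 𝓘(ℝ, EN) ∞ N]
  (gM : Metric EM M) (gN : Metric EN N) (F : M → N)

/-- A smooth map `F` is a Riemannian map if, at every point, its differential is isometric on the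
orthogonal complement of its kernel. -/
def IsRiemannianMap : Prop :=
  ContMDiff 𝓘(ℝ, EM) 𝓘(ℝ, EN) ∞ F ∧
    ∀ (p : M) (v w : TangentSpace 𝓘(ℝ, EM) p),
      (∀ k, mfderiv 𝓘(ℝ, EM) 𝓘(ℝ, EN) F p k = 0 → gM.inner p v k = 0) →
      (∀ k, mfderiv 𝓘(ℝ, EM) 𝓘(ℝ, EN) F p k = 0 → gM.inner p w k = 0) →
      gN.inner (F p) (mfderiv 𝓘(ℝ, EM) 𝓘(ℝ, EN) F p v) (mfderiv 𝓘(ℝ, EM) 𝓘(ℝ, EN) F p w)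
        = gM.inner p v w

/-- The pullback connection `∇^F_X σ` on `F⁻¹TN`, for a section `σ` of `F⁻¹TN`, at `p`.
In the frame `(e_i)` of `TN` around `F p` given by the standard trivialization, write
`σ = ∑ σ^i (e_i ∘ F)` near `p`; then
`∇^F_X σ = ∑ (X σ^i) e_i + ∇_{F_* X} (∑ σ^i(p) e_i)`, and `∑ σ^i(p) e_i = extendVec (σ p)`. -/
def pullbackCovDeriv (X : VField EM M) (σ : (q : M) → TangentSpace 𝓘(ℝ, EN) (F q)) (p : M) :
    TangentSpace 𝓘(ℝ, EN) (F p) :=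
  let t := trivializationAt EN (fun y : N => TangentSpace 𝓘(ℝ, EN) y) (F p)
  t.symm (F p) (mvfderiv 𝓘(ℝ, EM) (fun q => (t ⟨F q, σ q⟩).2) p (X p))
    + covDeriv gN (extendVec (mfderiv 𝓘(ℝ, EM) 𝓘(ℝ, EN) F p (X p))) (extendVec (σ p)) (F p)

/-- The second fundamental form `(∇F_*)(X,Y) = ∇^F_X (F_* Y) - F_*(∇_X Y)` of the map `F`. -/
def secondFundamentalForm (X Y : VField EM M) (p : M) : TangentSpace 𝓘(ℝ, EN) (F p) :=
  pullbackCovDeriv gN F X (fun q => mfderiv 𝓘(ℝ, EM) 𝓘(ℝ, EN) F q (Y q)) p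
    - mfderiv 𝓘(ℝ, EM) 𝓘(ℝ, EN) F p (covDeriv gM X Y p)

/-- The map `F` is totally geodesic: `∇F_* = 0`. -/
def IsTotallyGeodesicMap : Prop :=
  ∀ (u : Set M) (X Y : VField EM M), IsOpen u → SmoothFieldOn X u → SmoothFieldOn Y u →
    ∀ p ∈ u, secondFundamentalForm gM gN F X Y p = 0

/-- The distribution `D` on `N` is the range of `F_*`: its fibre at `F p` is `F_*(T_p M)`. -/
def IsRangeDistribution (D : PlaneField EN N) : Prop :=
  IsSmoothDistribution D ∧
    ∀ p : M, D (F p) = LinearMap.range (mfderiv 𝓘(ℝ, EM) 𝓘(ℝ, EN) F p).toLinearMap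

/-- `F : M → N` is an immersed integral manifold of `D`, and the metric of `M` is the one induced
from `N`. -/
def IsIntegralManifold (D : PlaneField EN N) : Prop :=
  ContMDiff 𝓘(ℝ, EM) 𝓘(ℝ, EN) ∞ F ∧
    ∀ p : M, Function.Injective (mfderiv 𝓘(ℝ, EM) 𝓘(ℝ, EN) F p) ∧
      LinearMap.range (mfderiv 𝓘(ℝ, EM) 𝓘(ℝ, EN) F p).toLinearMap = D (F p) ∧
      ∀ v w : TangentSpace 𝓘(ℝ, EM) p,
        gM.inner p v w = gN.inner (F p) (mfderiv 𝓘(ℝ, EM) 𝓘(ℝ, EN) F p v)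
          (mfderiv 𝓘(ℝ, EM) 𝓘(ℝ, EN) F p w)

end Maps

end RiemGeom

end

/-! Write D for the distribution `range F_*`. If D and its orthogonal complement are both totally
geodesic, then D is parallel: ∇_Z Y stays in D for Y tangent to D and Z arbitrary
(`covDeriv_mem_of_geodesicAt`). Indeed, split Z into a part in D and a normal part V; for a normal
field U one has g(∇_V Y, U) = -g(Y, ∇_V U) = 0. Hence R(Z,X)Y lies in D for every Z
(`curvature_mem`), and the trace defining Ric(X,Y) receives nothing from the normal directions.

On an integral manifold L of D the ambient derivative of tangent fields is already tangent, so the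
Koszul formula identifies the connection of L with that of N (`TangentPair.covDeriv`). Curvature,
and by the trace remark also Ricci (`TangentPair.ricci_eq`), then agree on vectors tangent to L.
Restrict the soliton equation of N to D. A tangent ξ has the same Lie derivative term on L as on N,
which gives (i). For a normal ξ, g(∇_X ξ, Y) = -g(ξ, ∇_X Y) = 0, so the Lie derivative term
disappears and Ric = -λ g remains, which gives (ii).

The map F serves only to make D totally geodesic on all of N (`geodesicAt_of_isRangeDistribution`).
Over the image, fields tangent to D lift through F (`exists_lift`), and ∇F_* = 0 writes ∇_X Y as F_*
of a vector; continuity extends this to the closure, and outside the closure it is assumed. -/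

open VectorField Filter
open scoped Topology

namespace RiemGeom

/-! ### Functions and vector fields smooth near a point -/

section Smooth

variable {E : Type*} [NormedAddCommGroup E] [NormedSpace ℝ E]
  {M : Type*} [TopologicalSpace M] [ChartedSpace E M]

instance finiteDimensional_tangentSpace [FiniteDimensional ℝ E] (x : M) :
    FiniteDimensional ℝ (TangentSpace 𝓘(ℝ, E) x) :=
  inferInstanceAs (FiniteDimensional ℝ E)

variable {x : M} {f h : M → ℝ} {u : Set M}

/-- The function `f` is smooth on a neighbourhood of `x`. -/
def SmoothFnAt (f : M → ℝ) (x : M) : Prop :=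
  ∀ᶠ y in 𝓝 x, ContMDiffAt 𝓘(ℝ, E) 𝓘(ℝ, ℝ) ∞ f y

/-- For order ∞, regularity at one point only yields neighbourhoods that depend on the finite order.
Requiring it at all nearby points makes the condition open, so that identities between fields can be
differentiated again. -/
lemma SmoothFnAt.eventually (hf : SmoothFnAt (E := E) f x) :
    ∀ᶠ y in 𝓝 x, SmoothFnAt (E := E) f y :=
  hf.eventually_nhds

lemma SmoothFnAt.contMDiffAt (hf : SmoothFnAt (E := E) f x) :
    ContMDiffAt 𝓘(ℝ, E) 𝓘(ℝ, ℝ) ∞ f x :=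
  hf.self_of_nhds

lemma SmoothFnAt.mdiff (hf : SmoothFnAt (E := E) f x) :
    MDifferentiableAt 𝓘(ℝ, E) 𝓘(ℝ, ℝ) f x :=
  hf.contMDiffAt.mdifferentiableAt (by simp)

lemma SmoothFnAt.congr (hf : SmoothFnAt (E := E) f x) (hh : h =ᶠ[𝓝 x] f) :
    SmoothFnAt (E := E) h x := by
  filter_upwards [hf, hh.eventually_nhds] with y hy hXY
  exact hy.congr_of_eventuallyEq hXY

lemma smoothFnAt_const (c : ℝ) : SmoothFnAt (E := E) (fun _ : M => c) x :=
  Eventually.of_forall fun _ => contMDiffAt_const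

lemma SmoothFnAt.add (hf : SmoothFnAt (E := E) f x) (hh : SmoothFnAt (E := E) h x) :
    SmoothFnAt (E := E) (f + h) x := by
  filter_upwards [hf, hh] with y h₁ h₂ using h₁.add h₂

lemma SmoothFnAt.sub (hf : SmoothFnAt (E := E) f x) (hh : SmoothFnAt (E := E) h x) :
    SmoothFnAt (E := E) (f - h) x := by
  filter_upwards [hf, hh] with y h₁ h₂ using h₁.sub h₂

lemma SmoothFnAt.mul (hf : SmoothFnAt (E := E) f x) (hh : SmoothFnAt (E := E) h x) :
    SmoothFnAt (E := E) (f * h) x := by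
  filter_upwards [hf, hh] with y h₁ h₂ using h₁.mul h₂

lemma SmoothFnAt.sum {ι : Type*} {s : Finset ι} {F : ι → M → ℝ}
    (hF : ∀ i ∈ s, SmoothFnAt (E := E) (F i) x) :
    SmoothFnAt (E := E) (fun y => ∑ i ∈ s, F i y) x := by
  filter_upwards [(Finset.eventually_all s).2 hF] with y hy using contMDiffAt_finsetSum hy

lemma SmoothFnAt.prod {ι : Type*} {s : Finset ι} {F : ι → M → ℝ}
    (hF : ∀ i ∈ s, SmoothFnAt (E := E) (F i) x) :
    SmoothFnAt (E := E) (fun y => ∏ i ∈ s, F i y) x := by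
  filter_upwards [(Finset.eventually_all s).2 hF] with y hy using contMDiffAt_finsetProd hy

lemma SmoothFnAt.inv (hf : SmoothFnAt (E := E) f x) (h0 : f x ≠ 0) :
    SmoothFnAt (E := E) (fun y => (f y)⁻¹) x := by
  filter_upwards [hf, hf.contMDiffAt.continuousAt.eventually_ne h0] with y h₁ h₂ using h₁.inv₀ h₂

lemma SmoothFnAt.det {n : Type*} [Fintype n] [DecidableEq n] {A : n → n → M → ℝ}
    (hA : ∀ i j, SmoothFnAt (E := E) (A i j) x) :
    SmoothFnAt (E := E) (fun y => (Matrix.of fun i j => A i j y).det) x := by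
  simp only [Matrix.det_apply']
  refine SmoothFnAt.sum fun σ _ => ?_
  exact (smoothFnAt_const _).mul (SmoothFnAt.prod fun i _ => hA _ _)

lemma SmoothFnAt.adjugate {n : Type*} [Fintype n] [DecidableEq n] {A : n → n → M → ℝ}
    (hA : ∀ i j, SmoothFnAt (E := E) (A i j) x) (i j : n) :
    SmoothFnAt (E := E) (fun y => (Matrix.of fun i j => A i j y).adjugate i j) x := by
  simp only [Matrix.adjugate_apply]
  have : ∀ k l, SmoothFnAt (E := E)
      (fun y => (Matrix.of fun i j => A i j y).updateRow j (Pi.single i 1) k l) x := by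
    intro k l
    by_cases hk : k = j
    · subst hk
      simpa using smoothFnAt_const (E := E) _
    · simpa [hk] using hA k l
  exact SmoothFnAt.det this

variable [IsManifold 𝓘(ℝ, E) ∞ M] {X Y : VField E M}

/-- The vector field `X` is smooth on a neighbourhood of `x`. -/
def SmoothAt (X : VField E M) (x : M) : Prop :=
  ∀ᶠ y in 𝓝 x, ContMDiffAt 𝓘(ℝ, E) 𝓘(ℝ, E).tangent ∞
    (fun z => (⟨z, X z⟩ : TangentBundle 𝓘(ℝ, E) M)) y

lemma SmoothAt.eventually (hX : SmoothAt X x) : ∀ᶠ y in 𝓝 x, SmoothAt X y :=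
  hX.eventually_nhds

lemma SmoothAt.contMDiffAt (hX : SmoothAt X x) :
    ContMDiffAt 𝓘(ℝ, E) 𝓘(ℝ, E).tangent ∞
      (fun z => (⟨z, X z⟩ : TangentBundle 𝓘(ℝ, E) M)) x :=
  hX.self_of_nhds

lemma SmoothAt.mdiff (hX : SmoothAt X x) : MDiffAt (T% X) x :=
  hX.contMDiffAt.mdifferentiableAt (by simp)

lemma SmoothFieldOn.smoothAt (hX : SmoothFieldOn X u) (hu : IsOpen u) (hx : x ∈ u) :
    SmoothAt X x := by
  filter_upwards [hu.mem_nhds hx] with y hy using hX.contMDiffAt (hu.mem_nhds hy)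

lemma smoothFieldOn_of_forall (hX : ∀ y ∈ u, SmoothAt X y) : SmoothFieldOn X u :=
  fun y hy => (hX y hy).contMDiffAt.contMDiffWithinAt

lemma SmoothAt.congr (hX : SmoothAt X x) (h : Y =ᶠ[𝓝 x] X) : SmoothAt Y x := by
  filter_upwards [hX, h.eventually_nhds] with y hy hXY
  exact hy.congr_of_eventuallyEq (hXY.mono fun z hz => by simp [hz])

lemma SmoothAt.add (hX : SmoothAt X x) (hY : SmoothAt Y x) : SmoothAt (X + Y) x := by
  filter_upwards [hX, hY] with y h₁ h₂ using h₁.add_section h₂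

lemma SmoothAt.sub (hX : SmoothAt X x) (hY : SmoothAt Y x) : SmoothAt (X - Y) x := by
  filter_upwards [hX, hY] with y h₁ h₂ using h₁.sub_section h₂

lemma SmoothAt.smul (hf : SmoothFnAt (E := E) f x) (hX : SmoothAt X x) :
    SmoothAt (f • X) x := by
  filter_upwards [hf, hX] with y h₁ h₂ using h₁.smul_section h₂

lemma SmoothAt.sum {ι : Type*} {s : Finset ι} {F : ι → VField E M}
    (hF : ∀ i ∈ s, SmoothAt (F i) x) : SmoothAt (fun y => ∑ i ∈ s, F i y) x := by
  filter_upwards [(Finset.eventually_all s).2 hF] with y hy using ContMDiffAt.sum_section hy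

lemma smoothAt_extendVec (v : TangentSpace 𝓘(ℝ, E) x) : SmoothAt (extendVec v) x := by
  obtain ⟨u, hu, h⟩ := FiberBundle.exists_contMDiffOn_extend 𝓘(ℝ, E) E (k := ∞) v
  filter_upwards [eventually_mem_nhds_iff.2 hu] with y hy using h.contMDiffAt hy

lemma extendVec_self (v : TangentSpace 𝓘(ℝ, E) x) : extendVec v x = v :=
  FiberBundle.extend_apply_self E v

lemma mdiffAt_extendVec (v : TangentSpace 𝓘(ℝ, E) x) : MDiffAt (T% (extendVec v)) x :=
  (smoothAt_extendVec v).mdiff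

lemma SmoothAt.bracket [FiniteDimensional ℝ E] (hX : SmoothAt X x) (hY : SmoothAt Y x) :
    SmoothAt (bracket X Y) x := by
  have : CompleteSpace E := FiniteDimensional.complete ℝ E
  have : IsManifold 𝓘(ℝ, E) (minSmoothness ℝ 2) M := by
    rw [minSmoothness_of_isRCLikeNormedField]; infer_instance
  have : IsManifold 𝓘(ℝ, E) (((⊤ : ℕ∞) : ℕ∞ω) + 1) M := by simpa
  filter_upwards [hX, hY] with y h₁ h₂
  exact ContMDiffAt.mlieBracket_vectorField (m := ⊤) (n := ⊤) h₁ h₂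
    (by rw [minSmoothness_of_isRCLikeNormedField]; simp)

lemma SmoothFnAt.dirDeriv (hX : SmoothAt X x) (hf : SmoothFnAt (E := E) f x) :
    SmoothFnAt (E := E) (dirDeriv X f) x := by
  obtain ⟨u, hu, huo, hxu⟩ := eventually_nhds_iff.1 (hX.and hf)
  have hfu : ContMDiffOn 𝓘(ℝ, E) 𝓘(ℝ, ℝ) ∞ f u := fun y hy => (hu y hy).2.contMDiffWithinAt
  -- The function X(f) is the fibre component of the tangent map of f composed with the section X.
  have hT := hfu.contMDiffOn_tangentMapWithin (m := ∞) (by simp) huo.uniqueMDiffOn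
  filter_upwards [huo.mem_nhds hxu] with y hy
  have h₀ := hT.contMDiffAt (x := ⟨y, X y⟩)
    ((huo.preimage (FiberBundle.continuous_proj E _)).mem_nhds hy)
  have h₁ := ContMDiffAt.comp (f := fun z => (⟨z, X z⟩ : TangentBundle 𝓘(ℝ, E) M)) y h₀ (hu y hy).1
  have h₂ := ContMDiffAt.comp y
    (contMDiff_snd_tangentBundle_modelSpace (n := ∞) ℝ 𝓘(ℝ, ℝ)).contMDiffAt h₁
  refine h₂.congr_of_eventuallyEq ?_
  filter_upwards [huo.mem_nhds hy] with z hz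
  change mfderiv 𝓘(ℝ, E) 𝓘(ℝ, ℝ) f z (X z) = mfderivWithin 𝓘(ℝ, E) 𝓘(ℝ, ℝ) f u z (X z)
  rw [mfderivWithin_of_isOpen huo hz]

lemma SmoothFnAt.ip (g : Metric E M) (hX : SmoothAt X x) (hY : SmoothAt Y x) :
    SmoothFnAt (E := E) (ip g X Y) x := by
  filter_upwards [hX, hY] with y h₁ h₂
  have : ContMDiffAt 𝓘(ℝ, E) (𝓘(ℝ, E).prod 𝓘(ℝ)) ∞
      (fun m ↦ TotalSpace.mk' ℝ (E := Bundle.Trivial M ℝ) m (g.inner m (X m) (Y m))) y :=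
    ContMDiffAt.clm_bundle_apply₂ (F₁ := E) (F₂ := E) g.contMDiff.contMDiffAt h₁ h₂
  rw [contMDiffAt_totalSpace] at this
  exact this.2

lemma mdiffAt_ip (g : Metric E M) (hX : MDiffAt (T% X) x) (hY : MDiffAt (T% Y) x) :
    MDiffAt (ip g X Y) x := by
  have : MDifferentiableAt 𝓘(ℝ, E) (𝓘(ℝ, E).prod 𝓘(ℝ))
      (fun m ↦ TotalSpace.mk' ℝ (E := Bundle.Trivial M ℝ) m (g.inner m (X m) (Y m))) x :=
    MDifferentiableAt.clm_bundle_apply₂ (F₁ := E) (F₂ := E)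
      (g.contMDiff.mdifferentiableAt (by simp)) hX hY
  rw [mdifferentiableAt_totalSpace] at this
  exact this.2

end Smooth

/-! ### The Levi-Civita connection from the Koszul formula -/

section Koszul

variable {E : Type*} [NormedAddCommGroup E] [NormedSpace ℝ E]
  {M : Type*} [TopologicalSpace M] [ChartedSpace E M]

section Derivation

variable {X Y : VField E M} {f h : M → ℝ} {x : M}

lemma dirDeriv_add_left : dirDeriv (X + Y) f x = dirDeriv X f x + dirDeriv Y f x :=
  map_add (mvfderiv 𝓘(ℝ, E) f x) (X x) (Y x)

lemma dirDeriv_smul_left : dirDeriv (h • X) f x = h x * dirDeriv X f x :=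
  map_smul (mvfderiv 𝓘(ℝ, E) f x) (h x) (X x)

lemma dirDeriv_add (hf : MDiffAt f x) (hh : MDiffAt h x) :
    dirDeriv X (f + h) x = dirDeriv X f x + dirDeriv X h x := by
  simp only [dirDeriv, mvfderiv_add hf hh]
  rfl

lemma dirDeriv_mul (hf : MDiffAt f x) (hh : MDiffAt h x) :
    dirDeriv X (f * h) x = f x * dirDeriv X h x + h x * dirDeriv X f x := by
  simp only [dirDeriv, mvfderiv_mul hf hh]
  rfl

lemma dirDeriv_congr (hfh : f =ᶠ[𝓝 x] h) : dirDeriv X f x = dirDeriv X h x := by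
  simp only [dirDeriv, mvfderiv, hfh.mfderiv_eq]
  rfl

lemma dirDeriv_const (c : ℝ) : dirDeriv X (fun _ => c) x = 0 := by
  simp only [dirDeriv, mvfderiv_const]
  rfl

lemma dirDeriv_congr_left (hXY : X x = Y x) : dirDeriv X f x = dirDeriv Y f x := by
  simp only [dirDeriv, hXY]

end Derivation

section Bracket

variable {X Y X' Y' : VField E M} {x : M}

lemma bracket_congr (hX : X =ᶠ[𝓝 x] X') (hY : Y =ᶠ[𝓝 x] Y') :
    bracket X Y x = bracket X' Y' x :=
  hX.mlieBracket_vectorField_eq hY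

lemma bracket_swap : bracket X Y x = - bracket Y X x :=
  mlieBracket_swap_apply

end Bracket

variable [IsManifold 𝓘(ℝ, E) ∞ M] (g : Metric E M)
  {X Y Z W X' Y' : VField E M} {f h : M → ℝ} {x : M}

lemma ip_add_left : ip g (X + Y) Z = ip g X Z + ip g Y Z := by
  ext y; simp [ip]

lemma ip_add_right : ip g X (Y + Z) = ip g X Y + ip g X Z := by
  ext y; simp [ip]

lemma ip_smul_left : ip g (f • X) Y = f * ip g X Y := by
  ext y; simp [ip]

lemma ip_smul_right : ip g X (f • Y) = f * ip g X Y := by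
  ext y; simp [ip]

lemma ip_comm : ip g X Y = ip g Y X := by
  ext y; exact g.symm _ _ _

variable {g} in
lemma inner_left_ext {a b : TangentSpace 𝓘(ℝ, E) x} (h : ∀ w, g.inner x a w = g.inner x b w) :
    a = b := by
  by_contra hab
  have := g.pos x (a - b) (sub_ne_zero.2 hab)
  rw [map_sub (g.inner x), sub_apply, h, sub_self] at this
  exact lt_irrefl _ this

/-- Riesz representation by dimension count: v ↦ g(v, ·) is injective by positivity, and the dual
has the same dimension. -/
lemma exists_inner_eq [FiniteDimensional ℝ E] (φ : TangentSpace 𝓘(ℝ, E) x →ₗ[ℝ] ℝ) :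
    ∃ a, ∀ w, g.inner x a w = φ w := by
  let B : TangentSpace 𝓘(ℝ, E) x →ₗ[ℝ] (TangentSpace 𝓘(ℝ, E) x →ₗ[ℝ] ℝ) :=
    { toFun := fun a => (g.inner x a).toLinearMap
      map_add' := fun a b => by ext; simp
      map_smul' := fun a b => by ext; simp }
  have hB : Function.Injective B := fun a b hab => inner_left_ext fun w => congr($hab w)
  have hs : Function.Surjective B :=
    (LinearMap.injective_iff_surjective_of_finrank_eq_finrank
      (Subspace.dual_finrank_eq (K := ℝ) (V := TangentSpace 𝓘(ℝ, E) x)).symm).1 hB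
  obtain ⟨a, ha⟩ := hs φ
  exact ⟨a, fun w => congr($ha w)⟩

lemma ip_congr (hX : X =ᶠ[𝓝 x] X') (hY : Y =ᶠ[𝓝 x] Y') : ip g X Y =ᶠ[𝓝 x] ip g X' Y' := by
  filter_upwards [hX, hY] with y h₁ h₂
  simp [ip, h₁, h₂]

lemma koszul_congr (hX : X =ᶠ[𝓝 x] X') (hY : Y =ᶠ[𝓝 x] Y') :
    koszul g X Y Z x = koszul g X' Y' Z x := by
  have hZ : Z =ᶠ[𝓝 x] Z := .rfl
  simp only [koszul]
  rw [dirDeriv_congr (ip_congr g hX hY), dirDeriv_congr (ip_congr g hX hZ),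
    dirDeriv_congr (ip_congr g hY hZ), dirDeriv_congr_left hX.self_of_nhds,
    dirDeriv_congr_left hY.self_of_nhds]
  simp only [ip]
  rw [bracket_congr hX hY, bracket_congr hX hZ, bracket_congr hY hZ, hX.self_of_nhds,
    hY.self_of_nhds]

lemma covDeriv_congr (hX : X =ᶠ[𝓝 x] X') (hY : Y =ᶠ[𝓝 x] Y') :
    covDeriv g X Y x = covDeriv g X' Y' x := by
  simp only [covDeriv, koszul_congr g hX hY]

variable [FiniteDimensional ℝ E]

lemma bracket_add_left (hX : MDiffAt (T% X) x) (hY : MDiffAt (T% Y) x) :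
    bracket (X + Y) Z x = bracket X Z x + bracket Y Z x :=
  have : CompleteSpace E := FiniteDimensional.complete ℝ E
  mlieBracket_add_left hX hY

lemma bracket_add_right (hX : MDiffAt (T% X) x) (hY : MDiffAt (T% Y) x) :
    bracket Z (X + Y) x = bracket Z X x + bracket Z Y x :=
  have : CompleteSpace E := FiniteDimensional.complete ℝ E
  mlieBracket_add_right hX hY

lemma bracket_smul_left (hf : MDiffAt f x) (hX : MDiffAt (T% X) x) :
    bracket (f • X) Y x = - dirDeriv Y f x • X x + f x • bracket X Y x :=
  have : CompleteSpace E := FiniteDimensional.complete ℝ E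
  mlieBracket_smul_left hf hX

lemma bracket_smul_right (hf : MDiffAt f x) (hY : MDiffAt (T% Y) x) :
    bracket X (f • Y) x = dirDeriv X f x • Y x + f x • bracket X Y x :=
  have : CompleteSpace E := FiniteDimensional.complete ℝ E
  mlieBracket_smul_right hf hY

lemma koszul_add_right (hX : MDiffAt (T% X) x) (hY : MDiffAt (T% Y) x) (hZ : MDiffAt (T% Z) x)
    (hW : MDiffAt (T% W) x) :
    koszul g X Y (Z + W) x = koszul g X Y Z x + koszul g X Y W x := by
  simp only [koszul, ip_add_right, dirDeriv_add_left,
    dirDeriv_add (mdiffAt_ip g hY hZ) (mdiffAt_ip g hY hW),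
    dirDeriv_add (mdiffAt_ip g hX hZ) (mdiffAt_ip g hX hW)]
  simp only [ip, bracket_add_right hZ hW, Pi.add_apply, map_add, add_apply]
  ring

lemma koszul_smul_right (hX : MDiffAt (T% X) x) (hY : MDiffAt (T% Y) x) (hf : MDiffAt f x)
    (hZ : MDiffAt (T% Z) x) :
    koszul g X Y (f • Z) x = f x * koszul g X Y Z x := by
  simp only [koszul, ip_smul_right, dirDeriv_smul_left, dirDeriv_mul hf (mdiffAt_ip g hY hZ),
    dirDeriv_mul hf (mdiffAt_ip g hX hZ)]
  simp only [ip, bracket_smul_right hf hZ, Pi.mul_apply, map_add, map_smul,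
    add_apply, smul_apply, smul_eq_mul,
    g.symm x (Z x) (Y x), g.symm x (Z x) (X x)]
  ring

/-- This makes the choice in `covDeriv` meaningful: the Koszul expression is a linear form in the
value of Z at the point, hence is represented by a vector and does not depend on how that value is
extended. -/
lemma koszul_tensorialAt (hX : MDiffAt (T% X) x) (hY : MDiffAt (T% Y) x) :
    TensorialAt 𝓘(ℝ, E) E (fun Z : VField E M => koszul g X Y Z x) x where
  smul hf hZ := koszul_smul_right g hX hY hf hZ
  add hZ hW := koszul_add_right g hX hY hZ hW

/-- The Koszul formula for the Levi-Civita covariant derivative. -/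
lemma two_mul_inner_covDeriv (hX : MDiffAt (T% X) x) (hY : MDiffAt (T% Y) x)
    (hZ : MDiffAt (T% Z) x) :
    2 * g.inner x (covDeriv g X Y x) (Z x) = koszul g X Y Z x := by
  have hT := koszul_tensorialAt g hX hY
  obtain ⟨a, ha⟩ := exists_inner_eq g
    ((1 / 2 : ℝ) • (TensorialAt.mkHom (fun Z : VField E M => koszul g X Y Z x) x hT).toLinearMap)
  have hex : ∃ a : TangentSpace 𝓘(ℝ, E) x,
      ∀ w : TangentSpace 𝓘(ℝ, E) x, 2 * g.inner x a w = koszul g X Y (extendVec w) x := by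
    refine ⟨a, fun w => ?_⟩
    rw [ha]
    change 2 * ((1 / 2 : ℝ) * koszul g X Y (extendVec w) x) = _
    ring
  have h := Classical.epsilon_spec hex (Z x)
  refine Eq.trans h ?_
  exact hT.pointwise (mdiffAt_extendVec _) hZ (extendVec_self _)

/-- The uniqueness half of the Koszul formula. The algebraic rules of the connection follow by
checking the proposed value against every test field. -/
lemma covDeriv_eq_of_forall {a : TangentSpace 𝓘(ℝ, E) x} (hX : MDiffAt (T% X) x)
    (hY : MDiffAt (T% Y) x)
    (h : ∀ Z : VField E M, MDiffAt (T% Z) x → 2 * g.inner x a (Z x) = koszul g X Y Z x) :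
    covDeriv g X Y x = a := by
  refine inner_left_ext (g := g) fun w => ?_
  have h₁ := two_mul_inner_covDeriv g hX hY (mdiffAt_extendVec w)
  have h₂ := h _ (mdiffAt_extendVec w)
  rw [extendVec_self] at h₁ h₂
  linarith

lemma covDeriv_add_left (hX : MDiffAt (T% X) x) (hX' : MDiffAt (T% X') x)
    (hY : MDiffAt (T% Y) x) :
    covDeriv g (X + X') Y x = covDeriv g X Y x + covDeriv g X' Y x := by
  refine covDeriv_eq_of_forall g (mdifferentiableAt_add_section hX hX') hY fun Z hZ => ?_
  simp only [map_add, add_apply, mul_add, two_mul_inner_covDeriv g hX hY hZ,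
    two_mul_inner_covDeriv g hX' hY hZ]
  simp only [koszul, ip_add_left, dirDeriv_add_left,
    dirDeriv_add (mdiffAt_ip g hX hZ) (mdiffAt_ip g hX' hZ),
    dirDeriv_add (mdiffAt_ip g hX hY) (mdiffAt_ip g hX' hY)]
  simp only [ip, bracket_add_left hX hX', Pi.add_apply, map_add, add_apply]
  ring

lemma covDeriv_smul_left (hf : MDiffAt f x) (hX : MDiffAt (T% X) x)
    (hY : MDiffAt (T% Y) x) :
    covDeriv g (f • X) Y x = f x • covDeriv g X Y x := by
  refine covDeriv_eq_of_forall g (hf.smul_section hX) hY fun Z hZ => ?_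
  rw [map_smul, smul_apply, smul_eq_mul, mul_left_comm,
    two_mul_inner_covDeriv g hX hY hZ]
  simp only [koszul, ip_smul_left, dirDeriv_smul_left, dirDeriv_mul hf (mdiffAt_ip g hX hZ),
    dirDeriv_mul hf (mdiffAt_ip g hX hY)]
  simp only [ip, bracket_smul_left hf hX, Pi.smul_apply', map_add, map_smul,
    add_apply, smul_apply, smul_eq_mul]
  ring

lemma covDeriv_add_right (hX : MDiffAt (T% X) x) (hY : MDiffAt (T% Y) x)
    (hY' : MDiffAt (T% Y') x) :
    covDeriv g X (Y + Y') x = covDeriv g X Y x + covDeriv g X Y' x := by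
  refine covDeriv_eq_of_forall g hX (mdifferentiableAt_add_section hY hY') fun Z hZ => ?_
  simp only [map_add, add_apply, mul_add, two_mul_inner_covDeriv g hX hY hZ,
    two_mul_inner_covDeriv g hX hY' hZ]
  simp only [koszul, ip_add_left, ip_add_right, dirDeriv_add_left,
    dirDeriv_add (mdiffAt_ip g hY hZ) (mdiffAt_ip g hY' hZ),
    dirDeriv_add (mdiffAt_ip g hX hY) (mdiffAt_ip g hX hY')]
  simp only [ip, bracket_add_left hY hY', bracket_add_right hY hY', Pi.add_apply, map_add,
    add_apply]
  ring

lemma covDeriv_smul_right (hX : MDiffAt (T% X) x) (hf : MDiffAt f x) (hY : MDiffAt (T% Y) x) :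
    covDeriv g X (f • Y) x = dirDeriv X f x • Y x + f x • covDeriv g X Y x := by
  refine covDeriv_eq_of_forall g hX (hf.smul_section hY) fun Z hZ => ?_
  rw [map_add, map_smul, map_smul, add_apply, smul_apply,
    smul_apply, smul_eq_mul, smul_eq_mul, mul_add, mul_left_comm 2 (f x),
    two_mul_inner_covDeriv g hX hY hZ]
  simp only [koszul, ip_smul_left, ip_smul_right, dirDeriv_smul_left,
    dirDeriv_mul hf (mdiffAt_ip g hY hZ), dirDeriv_mul hf (mdiffAt_ip g hX hY)]
  simp only [ip, bracket_smul_left hf hY, bracket_smul_right hf hY, Pi.mul_apply,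
    map_add, map_smul, add_apply, smul_apply, smul_eq_mul,
    g.symm x (Y x) (X x)]
  ring

/-- The Levi-Civita connection is torsion free. -/
lemma covDeriv_sub_swap (hX : MDiffAt (T% X) x) (hY : MDiffAt (T% Y) x) :
    covDeriv g X Y x - covDeriv g Y X x = bracket X Y x := by
  refine inner_left_ext (g := g) fun w => ?_
  have h₁ := two_mul_inner_covDeriv g hX hY (mdiffAt_extendVec w)
  have h₂ := two_mul_inner_covDeriv g hY hX (mdiffAt_extendVec w)
  simp only [koszul, ip_comm g (X := Y) (Y := X)] at h₁ h₂
  simp only [ip, bracket_swap (X := Y) (Y := X), map_neg, neg_apply,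
    extendVec_self] at h₁ h₂
  rw [map_sub, sub_apply]
  linarith

/-- The Levi-Civita connection is metric. -/
lemma dirDeriv_ip (hX : MDiffAt (T% X) x) (hY : MDiffAt (T% Y) x) (hZ : MDiffAt (T% Z) x) :
    dirDeriv X (ip g Y Z) x =
      g.inner x (covDeriv g X Y x) (Z x) + g.inner x (Y x) (covDeriv g X Z x) := by
  have h₁ := two_mul_inner_covDeriv g hX hY hZ
  have h₂ := two_mul_inner_covDeriv g hX hZ hY
  rw [g.symm x _ (Y x)] at h₂
  simp only [koszul, ip_comm g (X := Z) (Y := Y)] at h₁ h₂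
  simp only [ip, bracket_swap (X := Z) (Y := Y), map_neg, neg_apply] at h₁ h₂
  linarith

lemma covDeriv_tensorialAt (hY : MDiffAt (T% Y) x) :
    TensorialAt 𝓘(ℝ, E) E (fun X : VField E M => covDeriv g X Y x) x where
  smul hf hX := covDeriv_smul_left g hf hX hY
  add hX hX' := covDeriv_add_left g hX hX' hY

lemma covDeriv_congr_left (hX : MDiffAt (T% X) x) (hX' : MDiffAt (T% X') x)
    (hY : MDiffAt (T% Y) x) (h : X x = X' x) : covDeriv g X Y x = covDeriv g X' Y x :=
  (covDeriv_tensorialAt g hY).pointwise hX hX' h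

end Koszul

/-! ### Gram matrices, smooth frames and tensoriality -/

section Gram

variable {E : Type*} [NormedAddCommGroup E] [NormedSpace ℝ E]
  {M : Type*} [TopologicalSpace M] [ChartedSpace E M] [IsManifold 𝓘(ℝ, E) ∞ M]
  (g : Metric E M) {x : M}

/-- A kernel vector of the Gram matrix gives a combination s of the v i orthogonal to every v i, so
g(s,s) = 0 and s = 0, against independence. -/
lemma det_gram_ne_zero {ι : Type*} [Fintype ι] [DecidableEq ι]
    {v : ι → TangentSpace 𝓘(ℝ, E) x} (hv : LinearIndependent ℝ v) :
    (Matrix.of fun i j => g.inner x (v i) (v j)).det ≠ 0 := by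
  intro h0
  obtain ⟨c, hc, hc0⟩ := Matrix.exists_mulVec_eq_zero_iff.2 h0
  have h₁ : ∀ i, g.inner x (v i) (∑ j, c j • v j) = 0 := fun i => by
    have := congrFun hc0 i
    simpa [Matrix.mulVec, dotProduct, map_sum, mul_comm] using this
  have h₂ : ∑ j, c j • v j = 0 := by
    by_contra hne
    obtain ⟨s, hs⟩ : ∃ s, s = ∑ j, c j • v j := ⟨_, rfl⟩
    rw [← hs] at h₁ hne
    refine (g.pos x s hne).ne' ?_
    calc g.inner x s s = g.inner x (∑ j, c j • v j) s := by rw [← hs]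
      _ = 0 := by simp [map_sum, sum_apply, h₁]
  exact hc (funext (Fintype.linearIndependent_iff.1 hv c h₂))

/-- Given smooth linearly independent fields `X i`, there is a smooth field in their span with
prescribed smooth inner products with the `X i`. -/
lemma exists_smoothAt_inner_eq {ι : Type*} [Fintype ι] {X : ι → VField E M}
    (hX : ∀ i, SmoothAt (X i) x) (hli : ∀ᶠ y in 𝓝 x, LinearIndependent ℝ (fun i => X i y))
    {c : ι → M → ℝ} (hc : ∀ i, SmoothFnAt (E := E) (c i) x) :
    ∃ V : VField E M, SmoothAt V x ∧ ∀ᶠ y in 𝓝 x,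
      V y ∈ Submodule.span ℝ (range fun i => X i y) ∧ ∀ i, g.inner y (V y) (X i y) = c i y := by
  classical
  let G : M → Matrix ι ι ℝ := fun y => Matrix.of fun i j => ip g (X i) (X j) y
  have hG : ∀ i j, SmoothFnAt (E := E) (ip g (X i) (X j)) x :=
    fun i j => SmoothFnAt.ip g (hX i) (hX j)
  -- Cramer's rule: the coefficients are c times the inverse Gram matrix, written with determinant
  -- and adjugate so that their smoothness is visible.
  let a : ι → M → ℝ := fun i y => ∑ j, c j y * ((G y).det⁻¹ * (G y).adjugate j i)
  have ha : ∀ i, SmoothFnAt (E := E) (a i) x := fun i => SmoothFnAt.sum fun j _ =>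
    (hc j).mul (((SmoothFnAt.det hG).inv (det_gram_ne_zero g hli.self_of_nhds)).mul
      (SmoothFnAt.adjugate hG j i))
  refine ⟨fun y => ∑ i, a i y • X i y, SmoothAt.sum fun i _ => SmoothAt.smul (ha i) (hX i), ?_⟩
  filter_upwards [hli] with y hy
  have hdet : (G y).det ≠ 0 := det_gram_ne_zero g hy
  refine ⟨Submodule.sum_mem _ fun i _ => Submodule.smul_mem _ _
    (Submodule.subset_span ⟨i, rfl⟩), fun k => ?_⟩
  have hadj : ∀ j, ∑ i, (G y).adjugate j i * ip g (X i) (X k) y =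
      if j = k then (G y).det else 0 := by
    intro j
    have := congrFun (congrFun (Matrix.adjugate_mul (G y)) j) k
    simpa [Matrix.mul_apply, Matrix.one_apply, G] using this
  calc g.inner y (∑ i, a i y • X i y) (X k y)
      = ∑ i, a i y * ip g (X i) (X k) y := by
        rw [map_sum (g.inner y)]
        simp [sum_apply, ip]
    _ = ∑ j, c j y * ((G y).det⁻¹ * ∑ i, (G y).adjugate j i * ip g (X i) (X k) y) := by
        simp only [a, Finset.sum_mul, Finset.mul_sum]
        rw [Finset.sum_comm]
        exact Finset.sum_congr rfl fun _ _ => Finset.sum_congr rfl fun _ _ => by ring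
    _ = c k y := by
        simp [hadj, hdet]

/-- An operation on vector fields that respects addition and multiplication by functions, for
fields and functions smooth near `x`. -/
structure SmoothTensorialAt {A : Type*} [AddCommGroup A] [Module ℝ A] (Φ : VField E M → A)
    (x : M) : Prop where
  smul : ∀ {f : M → ℝ} {σ : VField E M}, SmoothFnAt (E := E) f x → SmoothAt σ x →
    Φ (f • σ) = f x • Φ σ
  add : ∀ {σ τ : VField E M}, SmoothAt σ x → SmoothAt τ x → Φ (σ + τ) = Φ σ + Φ τ

namespace SmoothTensorialAt

variable {A : Type*} [AddCommGroup A] [Module ℝ A] {Φ : VField E M → A}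

/-- Locality follows from linearity over functions: multiply both fields by the indicator of the set
where they agree. That function is 1 near x, so its germ is smooth and no bump function is needed.
-/
lemma germ (hΦ : SmoothTensorialAt Φ x) {σ τ : VField E M} (hσ : SmoothAt σ x)
    (hτ : SmoothAt τ x) (h : σ =ᶠ[𝓝 x] τ) : Φ σ = Φ τ := by
  classical
  let ψ : M → ℝ := fun y => if σ y = τ y then 1 else 0
  have hψx : ψ x = 1 := by simp [ψ, h.self_of_nhds]
  have hψστ : ψ • σ = ψ • τ := by
    funext y
    by_cases hy : σ y = τ y <;> simp [ψ, hy]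
  have hψ : SmoothFnAt (E := E) ψ x :=
    (smoothFnAt_const 1).congr (h.mono fun y hy => by simp [ψ, hy])
  calc Φ σ = Φ (ψ • σ) := by rw [hΦ.smul hψ hσ, hψx, one_smul]
    _ = Φ τ := by rw [hψστ, hΦ.smul hψ hτ, hψx, one_smul]

lemma zero (hΦ : SmoothTensorialAt Φ x) : Φ 0 = 0 := by
  have h0 : SmoothAt (0 : VField E M) x :=
    (SmoothAt.smul (smoothFnAt_const 0)
      (smoothAt_extendVec (0 : TangentSpace 𝓘(ℝ, E) x))).congr
      (.of_forall fun y => (zero_smul ℝ (extendVec (0 : TangentSpace 𝓘(ℝ, E) x) y)).symm)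
  have := hΦ.smul (smoothFnAt_const 0) h0
  simpa using this

lemma sum (hΦ : SmoothTensorialAt Φ x) {ι : Type*} {s : Finset ι} {σ : ι → VField E M}
    (hσ : ∀ i ∈ s, SmoothAt (σ i) x) : Φ (fun y => ∑ i ∈ s, σ i y) = ∑ i ∈ s, Φ (σ i) := by
  classical
  induction s using Finset.induction_on with
  | empty =>
    simp only [Finset.sum_empty]
    exact hΦ.zero
  | insert a s ha ih =>
    simp only [Finset.mem_insert, forall_eq_or_imp] at hσ
    simp only [Finset.sum_insert ha, ← ih hσ.2]
    exact hΦ.add hσ.1 (SmoothAt.sum hσ.2)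

end SmoothTensorialAt

variable [FiniteDimensional ℝ E]

variable (x) in
/-- Near each point there is a smooth frame, with respect to which smooth fields have smooth
coefficients. -/
lemma exists_smooth_frame : ∃ X : Fin (Module.finrank ℝ E) → VField E M,
    (∀ i, SmoothAt (X i) x) ∧
    (∀ᶠ y in 𝓝 x, LinearIndependent ℝ (fun i => X i y)) ∧
    (∀ᶠ y in 𝓝 x, Submodule.span ℝ (range fun i => X i y) = ⊤) ∧
    ∃ c : Fin (Module.finrank ℝ E) → (y : M) → TangentSpace 𝓘(ℝ, E) y →ₗ[ℝ] ℝ,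
      (∀ V, SmoothAt V x → ∀ i, SmoothFnAt (E := E) (fun y => c i y (V y)) x) ∧
      ∀ᶠ y in 𝓝 x, ∀ v, v = ∑ i, c i y v • X i y := by
  let t := trivializationAt E (TangentSpace 𝓘(ℝ, E) : M → Type _) x
  have hx : x ∈ t.baseSet := FiberBundle.mem_baseSet_trivializationAt' x
  let b := Module.finBasis ℝ E
  have hfr := t.isLocalFrameOn_localFrame_baseSet 𝓘(ℝ, E) ∞ b
  have hmem := t.open_baseSet.mem_nhds hx
  refine ⟨t.localFrame b, fun i => ?_, ?_, ?_, fun i => t.localFrameCoeff 𝓘(ℝ, E) b i, ?_, ?_⟩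
  · exact SmoothFieldOn.smoothAt (u := t.baseSet) (hfr.contMDiffOn i) t.open_baseSet hx
  · filter_upwards [hmem] with y hy using hfr.linearIndependent hy
  · filter_upwards [hmem] with y hy using top_le_iff.1 (hfr.generating hy)
  · intro V hV i
    filter_upwards [hmem, hV] with y hy hVy
    exact contMDiffAt_localFrameCoeff b hy hVy i
  · classical
    filter_upwards [hmem] with y hy v
    -- The frame expansion concerns sections, so v is turned into a section with value v at y and
    -- zero elsewhere.
    have := t.eq_sum_localFrameCoeff_smul (I := 𝓘(ℝ, E)) (b := b) (s := Function.update 0 y v) hy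
    simpa using this

/-- A field whose inner products with smooth fields are smooth is smooth. -/
lemma smoothAt_of_ip {V : VField E M}
    (h : ∀ W, SmoothAt W x → SmoothFnAt (E := E) (ip g V W) x) : SmoothAt V x := by
  obtain ⟨X, hX, hli, hspan, -⟩ := exists_smooth_frame (E := E) x
  -- The smooth field V' has the same inner products with a spanning frame as V; nondegeneracy then
  -- forces V = V' near x.
  obtain ⟨V', hV', hV''⟩ := exists_smoothAt_inner_eq g hX hli fun i => h _ (hX i)
  refine hV'.congr ?_
  filter_upwards [hspan, hV''] with y hy hVy
  refine inner_left_ext (g := g) fun w => ?_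
  have hw : w ∈ Submodule.span ℝ (range fun i => X i y) := hy ▸ Submodule.mem_top
  induction hw using Submodule.span_induction with
  | mem z hz =>
    obtain ⟨i, rfl⟩ := hz
    exact (hVy.2 i).symm
  | zero => simp
  | add a b _ _ ha hb => simp [ha, hb]
  | smul c a _ ha => simp [ha]

lemma SmoothAt.covDeriv {X Y : VField E M} (hX : SmoothAt X x) (hY : SmoothAt Y x) :
    SmoothAt (covDeriv g X Y) x := by
  refine smoothAt_of_ip g fun W hW => ?_
  have h : SmoothFnAt (E := E) (koszul g X Y W) x :=
    (((((SmoothFnAt.dirDeriv hX (.ip g hY hW)).add (.dirDeriv hY (.ip g hX hW))).sub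
      (.dirDeriv hW (.ip g hX hY))).add (.ip g (hX.bracket hY) hW)).sub
      (.ip g (hX.bracket hW) hY)).sub (.ip g (hY.bracket hW) hX)
  refine ((smoothFnAt_const (1 / 2)).mul h).congr ?_
  filter_upwards [hX.eventually, hY.eventually, hW.eventually] with y h₁ h₂ h₃
  simp only [Pi.mul_apply, ← two_mul_inner_covDeriv g h₁.mdiff h₂.mdiff h₃.mdiff, ip]
  ring

namespace SmoothTensorialAt

variable {A : Type*} [AddCommGroup A] [Module ℝ A] {Φ : VField E M → A}

/-- A tensorial operation only depends on the value of the field at the point. -/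
lemma pointwise (hΦ : SmoothTensorialAt Φ x) {σ τ : VField E M} (hσ : SmoothAt σ x)
    (hτ : SmoothAt τ x) (h : σ x = τ x) : Φ σ = Φ τ := by
  obtain ⟨X, hX, -, -, c, hc, hsum⟩ := exists_smooth_frame (E := E) x
  have key : ∀ {σ : VField E M}, SmoothAt σ x → Φ σ = ∑ i, c i x (σ x) • Φ (X i) := by
    intro σ hσ
    have hs : ∀ i, SmoothAt ((fun y => c i y (σ y)) • X i) x :=
      fun i => SmoothAt.smul (hc σ hσ i) (hX i)
    rw [hΦ.germ hσ (SmoothAt.sum fun i (_ : i ∈ Finset.univ) => hs i)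
      (hsum.mono fun y hy => hy (σ y)), hΦ.sum fun i _ => hs i]
    exact Finset.sum_congr rfl fun i _ => hΦ.smul (hc σ hσ i) (hX i)
  rw [key hσ, key hτ, h]

end SmoothTensorialAt

end Gram

/-! ### Curvature as a tensor, Ricci as a trace, the Lie derivative of the metric -/

section Curvature

variable {E : Type*} [NormedAddCommGroup E] [NormedSpace ℝ E] [FiniteDimensional ℝ E]
  {M : Type*} [TopologicalSpace M] [ChartedSpace E M] [IsManifold 𝓘(ℝ, E) ∞ M]
  {X Y Z X' Y' Z' : VField E M} {f : M → ℝ} {x : M}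

lemma bracket_jacobi (hX : SmoothAt X x) (hY : SmoothAt Y x) (hZ : SmoothAt Z x) :
    bracket X (bracket Y Z) x = bracket (bracket X Y) Z x + bracket Y (bracket X Z) x := by
  have : CompleteSpace E := FiniteDimensional.complete ℝ E
  have : IsManifold 𝓘(ℝ, E) (minSmoothness ℝ 3) M := by
    rw [minSmoothness_of_isRCLikeNormedField]; infer_instance
  have h2 : minSmoothness ℝ 2 ≤ ∞ := by
    rw [minSmoothness_of_isRCLikeNormedField]; exact WithTop.coe_le_coe.2 le_top
  exact leibniz_identity_mlieBracket_apply (hX.contMDiffAt.of_le h2) (hY.contMDiffAt.of_le h2)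
    (hZ.contMDiffAt.of_le h2)

/-- The bracket acts on functions as the commutator of derivations. -/
lemma dirDeriv_bracket (hX : SmoothAt X x) (hY : SmoothAt Y x) (hf : SmoothFnAt (E := E) f x) :
    dirDeriv (bracket X Y) f x = dirDeriv X (dirDeriv Y f) x - dirDeriv Y (dirDeriv X f) x := by
  -- The argument below needs a field Z with Z x ≠ 0, so dimension zero is treated apart.
  rcases subsingleton_or_nontrivial E with hE | hE
  · have h0 : ∀ (V : VField E M) (h : M → ℝ), dirDeriv V h x = 0 := fun V h => by
      have : V x = 0 := hE.elim (V x) 0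
      rw [dirDeriv, this, map_zero]
    simp [h0]
  obtain ⟨z, hz⟩ : ∃ z : TangentSpace 𝓘(ℝ, E) x, z ≠ 0 := exists_ne (0 : E)
  set Z : VField E M := extendVec z
  have hZ : SmoothAt Z x := smoothAt_extendVec z
  -- Expand the Jacobi identity for X, Y and f Z. The terms with first derivatives of f are
  -- symmetric in X and Y and cancel; comparing the coefficients of Z gives the commutator formula.
  have key : ∀ V W : VField E M, SmoothAt V x → SmoothAt W x →
      bracket V (bracket W (f • Z)) x = dirDeriv V (dirDeriv W f) x • Z x
        + dirDeriv W f x • bracket V Z x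
        + (dirDeriv V f x • bracket W Z x + f x • bracket V (bracket W Z) x) := by
    intro V W hV hW
    have h₁ : bracket W (f • Z) =ᶠ[𝓝 x] dirDeriv W f • Z + f • bracket W Z := by
      filter_upwards [hf.eventually, hZ.eventually] with y hfy hZy
      exact bracket_smul_right hfy.mdiff hZy.mdiff
    have hWf := SmoothFnAt.dirDeriv hW hf
    have hWZ := hW.bracket hZ
    rw [bracket_congr (.refl _ V) h₁, bracket_add_right (SmoothAt.smul hWf hZ).mdiff
      (SmoothAt.smul hf hWZ).mdiff, bracket_smul_right hWf.mdiff hZ.mdiff,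
      bracket_smul_right hf.mdiff hWZ.mdiff]
  have h := bracket_jacobi hX hY (SmoothAt.smul hf hZ)
  rw [key X Y hX hY, key Y X hY hX, bracket_smul_right hf.mdiff hZ.mdiff,
    bracket_jacobi hX hY hZ] at h
  have h' : (dirDeriv (bracket X Y) f x
      - (dirDeriv X (dirDeriv Y f) x - dirDeriv Y (dirDeriv X f) x)) • Z x = 0 := by
    rw [← sub_eq_zero] at h
    rw [← neg_eq_zero, ← h]
    module
  rcases smul_eq_zero.1 h' with h' | h'
  · exact sub_eq_zero.1 h'
  · exact absurd ((extendVec_self z).symm.trans h') hz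

variable (g : Metric E M)

lemma curvature_swap (hX : SmoothAt X x) (hY : SmoothAt Y x) (hZ : SmoothAt Z x) :
    curvature g X Y Z x = - curvature g Y X Z x := by
  have h : bracket X Y =ᶠ[𝓝 x] (fun _ : M => (-1 : ℝ)) • bracket Y X :=
    .of_forall fun y => bracket_swap.trans (neg_one_smul ℝ _).symm
  simp only [curvature]
  rw [covDeriv_congr g h (.refl _ Z),
    covDeriv_smul_left g (smoothFnAt_const _).mdiff (hY.bracket hX).mdiff hZ.mdiff]
  module

/-- The term -Y(f) ∇_X Z from differentiating f ∇_X Z cancels against the -Y(f) X contained in [f X,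
Y]. -/
lemma curvature_tensorial_left (hY : SmoothAt Y x) (hZ : SmoothAt Z x) :
    SmoothTensorialAt (fun X : VField E M => curvature g X Y Z x) x where
  smul {f X} hf hX := by
    have h₁ : covDeriv g (f • X) Z =ᶠ[𝓝 x] f • covDeriv g X Z := by
      filter_upwards [hf.eventually, hX.eventually, hZ.eventually] with y hfy hXy hZy
      exact covDeriv_smul_left g hfy.mdiff hXy.mdiff hZy.mdiff
    have h₂ : bracket (f • X) Y =ᶠ[𝓝 x] (fun y => - dirDeriv Y f y) • X + f • bracket X Y := by
      filter_upwards [hf.eventually, hX.eventually] with y hfy hXy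
      exact bracket_smul_left hfy.mdiff hXy.mdiff
    have hYf : SmoothFnAt (E := E) (fun y => - dirDeriv Y f y) x :=
      ((smoothFnAt_const (-1)).mul (SmoothFnAt.dirDeriv hY hf)).congr
        (.of_forall fun y => by simp)
    have hXY := hX.bracket hY
    have hXZ := hX.covDeriv g hZ
    simp only [curvature]
    rw [covDeriv_congr g (.refl _ Y) h₁, covDeriv_congr g h₂ (.refl _ Z),
      covDeriv_smul_left g hf.mdiff hX.mdiff (hY.covDeriv g hZ).mdiff,
      covDeriv_smul_right g hY.mdiff hf.mdiff hXZ.mdiff,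
      covDeriv_add_left g (SmoothAt.smul hYf hX).mdiff (SmoothAt.smul hf hXY).mdiff hZ.mdiff,
      covDeriv_smul_left g hYf.mdiff hX.mdiff hZ.mdiff,
      covDeriv_smul_left g hf.mdiff hXY.mdiff hZ.mdiff]
    module
  add {X X'} hX hX' := by
    have h₁ : covDeriv g (X + X') Z =ᶠ[𝓝 x] covDeriv g X Z + covDeriv g X' Z := by
      filter_upwards [hX'.eventually, hX.eventually, hZ.eventually] with y hfy hXy hZy
      exact covDeriv_add_left g hXy.mdiff hfy.mdiff hZy.mdiff
    have h₂ : bracket (X + X') Y =ᶠ[𝓝 x] bracket X Y + bracket X' Y := by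
      filter_upwards [hX'.eventually, hX.eventually] with y hfy hXy
      exact bracket_add_left hXy.mdiff hfy.mdiff
    simp only [curvature]
    rw [covDeriv_congr g (.refl _ Y) h₁, covDeriv_congr g h₂ (.refl _ Z),
      covDeriv_add_left g hX.mdiff hX'.mdiff (hY.covDeriv g hZ).mdiff,
      covDeriv_add_right g hY.mdiff (hX.covDeriv g hZ).mdiff (hX'.covDeriv g hZ).mdiff,
      covDeriv_add_left g (hX.bracket hY).mdiff (hX'.bracket hY).mdiff hZ.mdiff]
    module

/-- The second derivatives of f combine to X(Y f) - Y(X f) - [X,Y] f, which vanishes by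
`dirDeriv_bracket`; the mixed first-order terms are symmetric in X and Y. -/
lemma curvature_tensorial_right (hX : SmoothAt X x) (hY : SmoothAt Y x) :
    SmoothTensorialAt (fun Z : VField E M => curvature g X Y Z x) x where
  smul {f Z} hf hZ := by
    have key : ∀ V W : VField E M, SmoothAt V x → SmoothAt W x →
        covDeriv g V (covDeriv g W (f • Z)) x = dirDeriv V (dirDeriv W f) x • Z x
          + dirDeriv W f x • covDeriv g V Z x
          + (dirDeriv V f x • covDeriv g W Z x + f x • covDeriv g V (covDeriv g W Z) x) := by
      intro V W hV hW
      have h₁ : covDeriv g W (f • Z) =ᶠ[𝓝 x] dirDeriv W f • Z + f • covDeriv g W Z := by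
        filter_upwards [hW.eventually, hf.eventually, hZ.eventually] with y hWy hfy hZy
        exact covDeriv_smul_right g hWy.mdiff hfy.mdiff hZy.mdiff
      have hWf := SmoothFnAt.dirDeriv hW hf
      have hWZ := hW.covDeriv g hZ
      rw [covDeriv_congr g (.refl _ V) h₁, covDeriv_add_right g hV.mdiff
        (SmoothAt.smul hWf hZ).mdiff
        (SmoothAt.smul hf hWZ).mdiff, covDeriv_smul_right g hV.mdiff hWf.mdiff hZ.mdiff,
        covDeriv_smul_right g hV.mdiff hf.mdiff hWZ.mdiff]
    simp only [curvature]
    rw [key X Y hX hY, key Y X hY hX,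
      covDeriv_smul_right g (hX.bracket hY).mdiff hf.mdiff hZ.mdiff, dirDeriv_bracket hX hY hf]
    module
  add {Z Z'} hZ hZ' := by
    have key : ∀ V W : VField E M, SmoothAt V x → SmoothAt W x →
        covDeriv g V (covDeriv g W (Z + Z')) x =
          covDeriv g V (covDeriv g W Z) x + covDeriv g V (covDeriv g W Z') x := by
      intro V W hV hW
      have h₁ : covDeriv g W (Z + Z') =ᶠ[𝓝 x] covDeriv g W Z + covDeriv g W Z' := by
        filter_upwards [hW.eventually, hZ.eventually, hZ'.eventually] with y hWy hZy hZy'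
        exact covDeriv_add_right g hWy.mdiff hZy.mdiff hZy'.mdiff
      rw [covDeriv_congr g (.refl _ V) h₁,
        covDeriv_add_right g hV.mdiff (hW.covDeriv g hZ).mdiff (hW.covDeriv g hZ').mdiff]
    simp only [curvature]
    rw [key X Y hX hY, key Y X hY hX, covDeriv_add_right g (hX.bracket hY).mdiff hZ.mdiff hZ'.mdiff]
    module

/-- The value of the curvature at `x` only depends on the values of the fields at `x`. -/
lemma curvature_eq_of_eq (hX : SmoothAt X x) (hX' : SmoothAt X' x) (hY : SmoothAt Y x)
    (hY' : SmoothAt Y' x) (hZ : SmoothAt Z x) (hZ' : SmoothAt Z' x) (h₁ : X x = X' x)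
    (h₂ : Y x = Y' x) (h₃ : Z x = Z' x) : curvature g X Y Z x = curvature g X' Y' Z' x := by
  -- The middle argument is reduced to the first by antisymmetry.
  rw [(curvature_tensorial_left g hY hZ).pointwise hX hX' h₁, curvature_swap g hX' hY hZ,
    (curvature_tensorial_left g hX' hZ).pointwise hY hY' h₂, ← curvature_swap g hX' hY' hZ,
    (curvature_tensorial_right g hX' hY').pointwise hZ hZ' h₃]

/-- The endomorphism `v ↦ R(v, X)Y` of the tangent space at `x`. -/
noncomputable def curvatureEnd (hX : SmoothAt X x) (hY : SmoothAt Y x) :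
    TangentSpace 𝓘(ℝ, E) x →ₗ[ℝ] TangentSpace 𝓘(ℝ, E) x where
  toFun v := curvature g (extendVec v) X Y x
  map_add' v w := by
    have hv := smoothAt_extendVec v
    have hw := smoothAt_extendVec w
    rw [← (curvature_tensorial_left g hX hY).add hv hw]
    exact (curvature_tensorial_left g hX hY).pointwise (smoothAt_extendVec _) (hv.add hw)
      (by simp [extendVec_self])
  map_smul' c v := by
    have hv := smoothAt_extendVec v
    rw [RingHom.id_apply, ← (curvature_tensorial_left g hX hY).smul (smoothFnAt_const c) hv]
    exact (curvature_tensorial_left g hX hY).pointwise (smoothAt_extendVec _)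
      (SmoothAt.smul (smoothFnAt_const c) hv) (by simp [extendVec_self])

lemma curvatureEnd_apply (hX : SmoothAt X x) (hY : SmoothAt Y x) (hZ : SmoothAt Z x) :
    curvatureEnd g hX hY (Z x) = curvature g Z X Y x :=
  (curvature_tensorial_left g hX hY).pointwise (smoothAt_extendVec _) hZ (extendVec_self _)

lemma ricci_eq_trace (hX : SmoothAt X x) (hY : SmoothAt Y x) :
    ricci g X Y x = LinearMap.trace ℝ _ (curvatureEnd g hX hY) := by
  rw [LinearMap.trace_eq_matrix_trace ℝ (Module.finBasis ℝ (TangentSpace 𝓘(ℝ, E) x))]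
  simp only [Matrix.trace, Matrix.diag_apply, LinearMap.toMatrix_apply]
  rfl

lemma ricci_eq_of_eq (hX : SmoothAt X x) (hX' : SmoothAt X' x) (hY : SmoothAt Y x)
    (hY' : SmoothAt Y' x) (h₁ : X x = X' x) (h₂ : Y x = Y' x) :
    ricci g X Y x = ricci g X' Y' x := by
  simp only [ricci]
  exact Finset.sum_congr rfl fun i _ => by
    rw [curvature_eq_of_eq g (smoothAt_extendVec _) (smoothAt_extendVec _) hX hX' hY hY' rfl h₁ h₂]

/-- `(L_ξ g)(X, Y) = g(∇_X ξ, Y) + g(X, ∇_Y ξ)`. -/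
lemma lieDerivMetric_eq {ξ : VField E M} (hξ : SmoothAt ξ x) (hX : SmoothAt X x)
    (hY : SmoothAt Y x) :
    lieDerivMetric g ξ X Y x =
      g.inner x (covDeriv g X ξ x) (Y x) + g.inner x (X x) (covDeriv g Y ξ x) := by
  simp only [lieDerivMetric, dirDeriv_ip g hξ.mdiff hX.mdiff hY.mdiff, ip,
    ← covDeriv_sub_swap g hξ.mdiff hX.mdiff, ← covDeriv_sub_swap g hξ.mdiff hY.mdiff, map_sub,
    sub_apply]
  ring

end Curvature

/-! ### Orthogonal projection in a tangent space -/

section Submodule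

variable {E : Type*} [NormedAddCommGroup E] [NormedSpace ℝ E] [FiniteDimensional ℝ E]
  {M : Type*} [TopologicalSpace M] [ChartedSpace E M] [IsManifold 𝓘(ℝ, E) ∞ M]
  (g : Metric E M) {x : M}

/-- Orthogonal projection of a tangent vector onto a subspace. -/
lemma exists_mem_inner_eq (K : Submodule ℝ (TangentSpace 𝓘(ℝ, E) x))
    (v : TangentSpace 𝓘(ℝ, E) x) : ∃ a ∈ K, ∀ w ∈ K, g.inner x a w = g.inner x v w := by
  let B : K →ₗ[ℝ] Module.Dual ℝ K :=
    { toFun := fun a => (g.inner x a).toLinearMap ∘ₗ K.subtype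
      map_add' := fun a b => by ext; simp
      map_smul' := fun a b => by ext; simp }
  have hB : Function.Injective B := by
    rw [← LinearMap.ker_eq_bot, LinearMap.ker_eq_bot']
    intro a ha
    by_contra hne
    have h0 : g.inner x (a : TangentSpace 𝓘(ℝ, E) x) a = 0 := congr($ha a)
    exact (g.pos x a fun h => hne (Subtype.ext h)).ne' h0
  obtain ⟨a, ha⟩ := (LinearMap.injective_iff_surjective_of_finrank_eq_finrank
      (Subspace.dual_finrank_eq (K := ℝ) (V := K)).symm).1 hB
      ((g.inner x v).toLinearMap ∘ₗ K.subtype)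
  exact ⟨a, a.2, fun w hw => congr($ha ⟨w, hw⟩)⟩

/-- Double orthogonal complement: v minus its projection to K is normal to K, hence orthogonal to v
and to the projection, hence to itself. -/
lemma mem_of_inner_eq_zero {K : Submodule ℝ (TangentSpace 𝓘(ℝ, E) x)}
    {v : TangentSpace 𝓘(ℝ, E) x}
    (h : ∀ u, (∀ w ∈ K, g.inner x u w = 0) → g.inner x v u = 0) : v ∈ K := by
  obtain ⟨a, haK, ha⟩ := exists_mem_inner_eq g K v
  have h₁ : ∀ w ∈ K, g.inner x (v - a) w = 0 := fun w hw => by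
    rw [map_sub, sub_apply, ha w hw, sub_self]
  have h₂ : v - a = 0 := by
    by_contra hne
    refine (g.pos x _ hne).ne' ?_
    rw [map_sub (g.inner x), sub_apply, h _ h₁, g.symm x a, h₁ a haK, sub_zero]
  rwa [sub_eq_zero.1 h₂]

end Submodule

/-! ### Related fields, the pullback connection, lifts along Riemannian maps -/

section Maps

variable {EM : Type*} [NormedAddCommGroup EM] [NormedSpace ℝ EM]
  {M : Type*} [TopologicalSpace M] [ChartedSpace EM M]
  {EN : Type*} [NormedAddCommGroup EN] [NormedSpace ℝ EN]
  {N : Type*} [TopologicalSpace N] [ChartedSpace EN N]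
  {F : M → N} {p : M} {X Y Z : VField EM M} {X' Y' Z' : VField EN N} {f : N → ℝ}

/-- The vector fields `X` and `X'` are `F`-related near `p`. -/
def RelatedAt (F : M → N) (X : VField EM M) (X' : VField EN N) (p : M) : Prop :=
  ∀ᶠ q in 𝓝 p, mfderiv 𝓘(ℝ, EM) 𝓘(ℝ, EN) F q (X q) = X' (F q)

lemma RelatedAt.eventually (h : RelatedAt F X X' p) : ∀ᶠ q in 𝓝 p, RelatedAt F X X' q :=
  h.eventually_nhds

lemma dirDeriv_comp {q : M} (hF : MDifferentiableAt 𝓘(ℝ, EM) 𝓘(ℝ, EN) F q)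
    (hf : MDifferentiableAt 𝓘(ℝ, EN) 𝓘(ℝ, ℝ) f (F q)) :
    dirDeriv X (f ∘ F) q =
      mvfderiv 𝓘(ℝ, EN) f (F q) (mfderiv 𝓘(ℝ, EM) 𝓘(ℝ, EN) F q (X q)) :=
  mvfderiv_comp_apply q hf hF (X q)

lemma SmoothFnAt.comp (hF : ContMDiff 𝓘(ℝ, EM) 𝓘(ℝ, EN) ∞ F)
    (hf : SmoothFnAt (E := EN) f (F p)) : SmoothFnAt (E := EM) (f ∘ F) p := by
  filter_upwards [hF.continuous.continuousAt.eventually hf] with q hq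
  exact hq.comp q hF.contMDiffAt

lemma dirDeriv_comp_related (hF : ContMDiff 𝓘(ℝ, EM) 𝓘(ℝ, EN) ∞ F) (hX : RelatedAt F X X' p)
    (hf : SmoothFnAt (E := EN) f (F p)) :
    dirDeriv X (f ∘ F) =ᶠ[𝓝 p] dirDeriv X' f ∘ F := by
  filter_upwards [hX, hF.continuous.continuousAt.eventually hf.eventually] with q hq hfq
  rw [dirDeriv_comp (hF.contMDiffAt.mdifferentiableAt (by simp)) hfq.mdiff, hq]
  rfl

variable [IsManifold 𝓘(ℝ, EN) ∞ N]

/-- Tangent vectors that agree as derivations are equal. -/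
lemma eq_of_forall_mvfderiv_eq {y : N} {v w : TangentSpace 𝓘(ℝ, EN) y}
    (h : ∀ f : N → ℝ, SmoothFnAt (E := EN) f y →
      mvfderiv 𝓘(ℝ, EN) f y v = mvfderiv 𝓘(ℝ, EN) f y w) : v = w := by
  have hinv := isInvertible_mfderiv_extChartAt (I := 𝓘(ℝ, EN))
    (mem_extChartAt_source (I := 𝓘(ℝ, EN)) y)
  refine hinv.injective ?_
  by_contra hne
  -- If the coordinate images differ, a linear functional φ separates them, and φ composed with the
  -- chart is a function with different derivatives along v and w.
  obtain ⟨φ, hφ⟩ := SeparatingDual.exists_ne_zero (R := ℝ) (V := EN) (sub_ne_zero.2 hne)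
  have hs : ∀ᶠ z in 𝓝 y, ContMDiffAt 𝓘(ℝ, EN) 𝓘(ℝ, EN) ∞ (extChartAt 𝓘(ℝ, EN) y) z := by
    filter_upwards [(chartAt EN y).open_source.mem_nhds (mem_chart_source EN y)] with z hz
    exact contMDiffAt_extChartAt' hz
  have hφs : ContMDiff 𝓘(ℝ, EN) 𝓘(ℝ, ℝ) ∞ φ := φ.contDiff.contMDiff
  have hsm : SmoothFnAt (E := EN) (φ ∘ extChartAt 𝓘(ℝ, EN) y) y := by
    filter_upwards [hs] with z hz using hφs.contMDiffAt.comp z hz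
  have key : ∀ v : TangentSpace 𝓘(ℝ, EN) y,
      mvfderiv 𝓘(ℝ, EN) (φ ∘ extChartAt 𝓘(ℝ, EN) y) y v
        = φ (mfderiv 𝓘(ℝ, EN) 𝓘(ℝ, EN) (extChartAt 𝓘(ℝ, EN) y) y v) := by
    intro v
    rw [mvfderiv_comp_apply y (hφs.mdifferentiableAt (by simp))
      (hs.self_of_nhds.mdifferentiableAt (by simp))]
    simp only [mvfderiv, mfderiv_eq_fderiv, φ.fderiv]
    rfl
  refine hφ ?_
  have := h _ hsm
  rw [key, key] at this
  exact (map_sub φ _ _).trans (sub_eq_zero.2 this)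

section Pullback

variable [FiniteDimensional ℝ EN] (gN : Metric EN N)

/-- In the standard trivialization, `∇_X Y` is the derivative of the components of `Y` plus a
term depending only on the values of `X` and `Y` at the point. -/
lemma covDeriv_eq_add {y : N} (hX' : MDiffAt (T% X') y) (hY' : MDiffAt (T% Y') y) :
    covDeriv gN X' Y' y =
      (trivializationAt EN (fun y : N => TangentSpace 𝓘(ℝ, EN) y) y).symm y
        (mvfderiv 𝓘(ℝ, EN) (fun z =>
          (trivializationAt EN (fun y : N => TangentSpace 𝓘(ℝ, EN) y) y ⟨z, Y' z⟩).2) y (X' y))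
      + covDeriv gN X' (extendVec (Y' y)) y := by
  set t := trivializationAt EN (fun y : N => TangentSpace 𝓘(ℝ, EN) y) y with ht
  have hy : t.baseSet ∈ 𝓝 y := t.open_baseSet.mem_nhds (FiberBundle.mem_baseSet_trivializationAt' y)
  let c : VField EN N → N → EN := fun V z => (t ⟨z, V z⟩).2
  have hc : ∀ V : VField EN N, MDiffAt (T% V) y → MDifferentiableAt 𝓘(ℝ, EN) 𝓘(ℝ, EN) (c V) y := by
    intro V hV
    rw [mdifferentiableAt_totalSpace] at hV
    exact hV.2
  -- Both terms obey the Leibniz rule with the same term X'(f) V, so their difference is tensorial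
  -- in V. It can therefore be evaluated on the extension with constant components, where the
  -- derivative term vanishes (`hext`).
  have hΦ : TensorialAt 𝓘(ℝ, EN) EN (fun V : VField EN N =>
      covDeriv gN X' V y - t.symmL ℝ y (mvfderiv 𝓘(ℝ, EN) (c V) y (X' y))) y := by
    constructor
    · intro f V hf hV
      have h₁ : c (f • V) =ᶠ[𝓝 y] f • c V := by
        filter_upwards [hy] with z hz
        exact (t.linear ℝ hz).map_smul (f z) (V z)
      have h₂ : mvfderiv 𝓘(ℝ, EN) (c (f • V)) y = mvfderiv 𝓘(ℝ, EN) (f • c V) y := by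
        simp only [mvfderiv, h₁.mfderiv_eq]
        rfl
      have h₃ : t.symmL ℝ y (c V y) = V y :=
        (t.symmL_apply (R := ℝ) (mem_of_mem_nhds hy) _).trans
          (t.symm_apply_apply_mk (mem_of_mem_nhds hy) (V y))
      rw [h₂, mvfderiv_smul hf (hc V hV), covDeriv_smul_right gN hX' hf hV]
      simp only [add_apply, smul_apply, ContinuousLinearMap.smulRight_apply, map_add, map_smul, h₃]
      simp only [dirDeriv]
      module
    · intro V W hV hW
      have h₁ : c (V + W) =ᶠ[𝓝 y] c V + c W := by
        filter_upwards [hy] with z hz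
        exact (t.linear ℝ hz).map_add (V z) (W z)
      have h₂ : mvfderiv 𝓘(ℝ, EN) (c (V + W)) y = mvfderiv 𝓘(ℝ, EN) (c V + c W) y := by
        simp only [mvfderiv, h₁.mfderiv_eq]
        rfl
      rw [h₂, mvfderiv_add (hc V hV) (hc W hW), covDeriv_add_right gN hX' hV hW]
      simp only [add_apply, map_add]
      module
  have hext : mvfderiv 𝓘(ℝ, EN) (c (extendVec (Y' y))) y = 0 := by
    have h₁ : c (extendVec (Y' y)) =ᶠ[𝓝 y] fun _ => (t ⟨y, Y' y⟩).2 := by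
      filter_upwards [hy] with z hz
      simp [c, extendVec, FiberBundle.extend, ← ht, Trivialization.apply_mk_symm t hz]
    have h₂ : mvfderiv 𝓘(ℝ, EN) (c (extendVec (Y' y))) y
        = mvfderiv 𝓘(ℝ, EN) (fun _ : N => (t ⟨y, Y' y⟩).2) y := by
      simp only [mvfderiv, h₁.mfderiv_eq]
      rfl
    rw [h₂, mvfderiv_const]
  have h := hΦ.pointwise hY' (mdiffAt_extendVec (Y' y)) (extendVec_self _).symm
  simp only [hext] at h
  rw [sub_eq_iff_eq_add] at h
  rw [h, add_comm, zero_apply, map_zero, sub_zero, t.symmL_apply (R := ℝ) (mem_of_mem_nhds hy)]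

/-- For a field along `F` that is the restriction of a field on the target, the pullback
connection is the covariant derivative in the target. -/
lemma pullbackCovDeriv_eq (hF : MDifferentiableAt 𝓘(ℝ, EM) 𝓘(ℝ, EN) F p)
    {σ : (q : M) → TangentSpace 𝓘(ℝ, EN) (F q)} (hX' : MDiffAt (T% X') (F p))
    (hY' : MDiffAt (T% Y') (F p)) (hX : mfderiv 𝓘(ℝ, EM) 𝓘(ℝ, EN) F p (X p) = X' (F p))
    (hσ : ∀ᶠ q in 𝓝 p, σ q = Y' (F q)) :
    pullbackCovDeriv gN F X σ p = covDeriv gN X' Y' (F p) := by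
  set t := trivializationAt EN (fun y : N => TangentSpace 𝓘(ℝ, EN) y) (F p) with ht
  have h₁ : (fun q => (t ⟨F q, σ q⟩).2) =ᶠ[𝓝 p] (fun z => (t ⟨z, Y' z⟩).2) ∘ F := by
    filter_upwards [hσ] with q hq
    simp [hq]
  have h₂ : MDifferentiableAt 𝓘(ℝ, EN) 𝓘(ℝ, EN) (fun z => (t ⟨z, Y' z⟩).2) (F p) := by
    rw [mdifferentiableAt_totalSpace] at hY'
    exact hY'.2
  have h₃ : mvfderiv 𝓘(ℝ, EM) (fun q => (t ⟨F q, σ q⟩).2) p (X p)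
      = mvfderiv 𝓘(ℝ, EN) (fun z => (t ⟨z, Y' z⟩).2) (F p) (X' (F p)) := by
    rw [← hX]
    simp only [mvfderiv, h₁.mfderiv_eq]
    exact congr($(mfderiv_comp p h₂ hF) (X p))
  rw [covDeriv_eq_add gN hX' hY']
  simp only [pullbackCovDeriv, ← ht, h₃, hX, hσ.self_of_nhds]
  rw [covDeriv_congr_left gN (mdiffAt_extendVec _) hX' (mdiffAt_extendVec _) (extendVec_self _)]

end Pullback

variable [IsManifold 𝓘(ℝ, EM) ∞ M]

variable [FiniteDimensional ℝ EM] (gM : Metric EM M) (gN : Metric EN N)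

/-- A field along a Riemannian map that is tangent to its range lifts to a smooth field. -/
lemma exists_lift (hF : IsRiemannianMap gM gN F) (hX' : SmoothAt X' (F p))
    (hrange : ∀ᶠ q in 𝓝 p,
      X' (F q) ∈ LinearMap.range (mfderiv 𝓘(ℝ, EM) 𝓘(ℝ, EN) F q).toLinearMap) :
    ∃ X : VField EM M, SmoothAt X p ∧ RelatedAt F X X' p := by
  obtain ⟨hFs, hFi⟩ := hF
  -- The lift is the adjoint of F_* applied to X'. Its inner products with smooth fields are visibly
  -- smooth, so no constant rank argument is required.
  choose X hX using fun q : M => exists_inner_eq gM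
    ((gN.inner (F q) (X' (F q))).toLinearMap ∘ₗ (mfderiv 𝓘(ℝ, EM) 𝓘(ℝ, EN) F q).toLinearMap)
  refine ⟨X, smoothAt_of_ip gM fun W hW => ?_, ?_⟩
  · have hT : ContMDiff 𝓘(ℝ, EM).tangent 𝓘(ℝ, EN).tangent ∞ (tangentMap 𝓘(ℝ, EM) 𝓘(ℝ, EN) F) :=
      hFs.contMDiff_tangentMap (by simp)
    filter_upwards [hW, hFs.continuous.continuousAt.eventually hX'] with q hWq hXq
    have h₁ : ContMDiffAt 𝓘(ℝ, EM) 𝓘(ℝ, EN).tangent ∞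
        (fun q => (⟨F q, mfderiv 𝓘(ℝ, EM) 𝓘(ℝ, EN) F q (W q)⟩ : TangentBundle 𝓘(ℝ, EN) N)) q :=
      ContMDiffAt.comp (f := fun z => (⟨z, W z⟩ : TangentBundle 𝓘(ℝ, EM) M)) q
        hT.contMDiffAt hWq
    have h₂ : ContMDiffAt 𝓘(ℝ, EM) 𝓘(ℝ, EN).tangent ∞
        (fun q => (⟨F q, X' (F q)⟩ : TangentBundle 𝓘(ℝ, EN) N)) q :=
      ContMDiffAt.comp (f := F) q hXq hFs.contMDiffAt
    have : ContMDiffAt 𝓘(ℝ, EM) (𝓘(ℝ, EN).prod 𝓘(ℝ)) ∞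
        (fun m ↦ TotalSpace.mk' ℝ (E := Bundle.Trivial N ℝ) (F m)
          (gN.inner (F m) (X' (F m)) (mfderiv 𝓘(ℝ, EM) 𝓘(ℝ, EN) F m (W m)))) q :=
      ContMDiffAt.clm_bundle_apply₂ (F₁ := EN) (F₂ := EN)
        (ContMDiffAt.comp (f := F) q gN.contMDiff.contMDiffAt hFs.contMDiffAt) h₂ h₁
    rw [contMDiffAt_totalSpace] at this
    exact this.2.congr_of_eventuallyEq (.of_forall fun z => hX z (W z))
  · filter_upwards [hrange] with q hq
    obtain ⟨v, hv⟩ := hq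
    set K := LinearMap.ker (mfderiv 𝓘(ℝ, EM) 𝓘(ℝ, EN) F q).toLinearMap
    have hK : ∀ k, k ∈ K ↔ mfderiv 𝓘(ℝ, EM) 𝓘(ℝ, EN) F q k = 0 := fun k => LinearMap.mem_ker
    have hdec : ∀ v, ∃ h, mfderiv 𝓘(ℝ, EM) 𝓘(ℝ, EN) F q h = mfderiv 𝓘(ℝ, EM) 𝓘(ℝ, EN) F q v ∧
        (∀ k, mfderiv 𝓘(ℝ, EM) 𝓘(ℝ, EN) F q k = 0 → gM.inner q h k = 0) ∧ v - h ∈ K := by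
      intro v
      obtain ⟨a, haK, ha⟩ := exists_mem_inner_eq gM K v
      refine ⟨v - a, ?_, fun k hk => ?_, by simpa using haK⟩
      · rw [map_sub, (hK a).1 haK, sub_zero]
      · rw [map_sub, sub_apply, ha k ((hK k).2 hk), sub_self]
    obtain ⟨h, hhv, hh, -⟩ := hdec v
    -- Where X' = F_* h with h horizontal, the adjoint returns h itself, because F_* is isometric on
    -- horizontal vectors and kills the vertical part of w.
    have hXh : X q = h := by
      refine inner_left_ext (g := gM) fun w => ?_
      obtain ⟨w', hww', hw', hwK⟩ := hdec w
      calc gM.inner q (X q) w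
          = gN.inner (F q) (X' (F q)) (mfderiv 𝓘(ℝ, EM) 𝓘(ℝ, EN) F q w) := hX q w
        _ = gN.inner (F q) (mfderiv 𝓘(ℝ, EM) 𝓘(ℝ, EN) F q h)
              (mfderiv 𝓘(ℝ, EM) 𝓘(ℝ, EN) F q w') := by
            rw [hww', hhv, ← hv]; rfl
        _ = gM.inner q h w' := hFi q h w' hh hw'
        _ = gM.inner q h w := by
            have := hh _ ((hK _).1 hwK)
            rw [map_sub] at this
            linarith
    rw [hXh, hhv, ← hv]
    rfl

variable [FiniteDimensional ℝ EN]

/-- Brackets of related fields are related. -/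
lemma RelatedAt.bracket (hF : ContMDiff 𝓘(ℝ, EM) 𝓘(ℝ, EN) ∞ F) (hX : SmoothAt X p)
    (hX' : SmoothAt X' (F p)) (hY : SmoothAt Y p) (hY' : SmoothAt Y' (F p))
    (hXX' : RelatedAt F X X' p) (hYY' : RelatedAt F Y Y' p) :
    RelatedAt F (bracket X Y) (bracket X' Y') p := by
  filter_upwards [hX.eventually, hF.continuous.continuousAt.eventually hX'.eventually,
    hY.eventually, hF.continuous.continuousAt.eventually hY'.eventually, hXX'.eventually,
    hYY'.eventually] with q hX hX' hY hY' hXX' hYY'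
  refine eq_of_forall_mvfderiv_eq fun f hf => ?_
  have hFq : MDifferentiableAt 𝓘(ℝ, EM) 𝓘(ℝ, EN) F q := hF.contMDiffAt.mdifferentiableAt (by simp)
  rw [← dirDeriv_comp hFq hf.mdiff, dirDeriv_bracket hX hY (hf.comp hF),
    dirDeriv_congr (dirDeriv_comp_related hF hXX' hf),
    dirDeriv_congr (dirDeriv_comp_related hF hYY' hf)]
  change _ = dirDeriv (RiemGeom.bracket X' Y') f (F q)
  rw [dirDeriv_bracket hX' hY' hf,
    (dirDeriv_comp_related hF hXX' (SmoothFnAt.dirDeriv hY' hf)).self_of_nhds,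
    (dirDeriv_comp_related hF hYY' (SmoothFnAt.dirDeriv hX' hf)).self_of_nhds]
  rfl

/-- The Koszul expression is built from inner products, derivatives along fields and brackets, and
each of these is compatible with F-relatedness when the metric is pulled back. -/
lemma koszul_related (hF : ContMDiff 𝓘(ℝ, EM) 𝓘(ℝ, EN) ∞ F)
    (hiso : ∀ (q : M) (v w : TangentSpace 𝓘(ℝ, EM) q), gM.inner q v w =
      gN.inner (F q) (mfderiv 𝓘(ℝ, EM) 𝓘(ℝ, EN) F q v) (mfderiv 𝓘(ℝ, EM) 𝓘(ℝ, EN) F q w))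
    (hX : SmoothAt X p) (hX' : SmoothAt X' (F p)) (hY : SmoothAt Y p) (hY' : SmoothAt Y' (F p))
    (hZ : SmoothAt Z p) (hZ' : SmoothAt Z' (F p))
    (hXX' : RelatedAt F X X' p) (hYY' : RelatedAt F Y Y' p) (hZZ' : RelatedAt F Z Z' p) :
    koszul gM X Y Z p = koszul gN X' Y' Z' (F p) := by
  have hip : ∀ {V W : VField EM M} {V' W' : VField EN N}, RelatedAt F V V' p →
      RelatedAt F W W' p → ip gM V W =ᶠ[𝓝 p] ip gN V' W' ∘ F := by
    intro V W V' W' hV hW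
    filter_upwards [hV, hW] with q h₁ h₂
    simp only [ip, Function.comp_apply, hiso, h₁, h₂]
  have hd : ∀ {U V W : VField EM M} {U' V' W' : VField EN N}, RelatedAt F U U' p →
      RelatedAt F V V' p → RelatedAt F W W' p → SmoothAt V' (F p) → SmoothAt W' (F p) →
      dirDeriv U (ip gM V W) p = dirDeriv U' (ip gN V' W') (F p) := by
    intro U V W U' V' W' hU hV hW hV' hW'
    rw [dirDeriv_congr (hip hV hW),
      (dirDeriv_comp_related hF hU (SmoothFnAt.ip gN hV' hW')).self_of_nhds]
    rfl
  have hXY := RelatedAt.bracket hF hX hX' hY hY' hXX' hYY'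
  have hXZ := RelatedAt.bracket hF hX hX' hZ hZ' hXX' hZZ'
  have hYZ := RelatedAt.bracket hF hY hY' hZ hZ' hYY' hZZ'
  simp only [koszul]
  rw [hd hXX' hYY' hZZ' hY' hZ', hd hYY' hXX' hZZ' hX' hZ', hd hZZ' hXX' hYY' hX' hY',
    (hip hXY hZZ').self_of_nhds, (hip hXZ hYY').self_of_nhds, (hip hYZ hXX').self_of_nhds]
  rfl

/-- Gauss formula for an isometric immersion, in the case where `∇_X' Y'` is tangent. -/
lemma mfderiv_covDeriv (hF : ContMDiff 𝓘(ℝ, EM) 𝓘(ℝ, EN) ∞ F)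
    (hiso : ∀ (q : M) (v w : TangentSpace 𝓘(ℝ, EM) q), gM.inner q v w =
      gN.inner (F q) (mfderiv 𝓘(ℝ, EM) 𝓘(ℝ, EN) F q v) (mfderiv 𝓘(ℝ, EM) 𝓘(ℝ, EN) F q w))
    (hX : SmoothAt X p) (hX' : SmoothAt X' (F p)) (hY : SmoothAt Y p) (hY' : SmoothAt Y' (F p))
    (hXX' : RelatedAt F X X' p) (hYY' : RelatedAt F Y Y' p)
    (hext : ∀ w : TangentSpace 𝓘(ℝ, EM) p, ∃ (Z : VField EM M) (Z' : VField EN N),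
      SmoothAt Z p ∧ SmoothAt Z' (F p) ∧ RelatedAt F Z Z' p ∧ Z p = w)
    {a : TangentSpace 𝓘(ℝ, EM) p}
    (ha : mfderiv 𝓘(ℝ, EM) 𝓘(ℝ, EN) F p a = covDeriv gN X' Y' (F p)) :
    mfderiv 𝓘(ℝ, EM) 𝓘(ℝ, EN) F p (covDeriv gM X Y p) = covDeriv gN X' Y' (F p) := by
  suffices h : covDeriv gM X Y p = a by rw [h, ha]
  refine inner_left_ext (g := gM) fun w => ?_
  obtain ⟨Z, Z', hZ, hZ', hZZ', rfl⟩ := hext w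
  have h₁ := two_mul_inner_covDeriv gM hX.mdiff hY.mdiff hZ.mdiff
  have h₂ := two_mul_inner_covDeriv gN hX'.mdiff hY'.mdiff hZ'.mdiff
  rw [koszul_related gM gN hF hiso hX hX' hY hY' hZ hZ' hXX' hYY' hZZ', ← h₂] at h₁
  rw [hiso p a, ha, hZZ'.self_of_nhds]
  linarith

end Maps

/-! ### Smooth distributions, their complements, and parallelism -/

section Distributions

variable {E : Type*} [NormedAddCommGroup E] [NormedSpace ℝ E]
  {M : Type*} [TopologicalSpace M] [ChartedSpace E M]
  {D : PlaneField E M} {x : M} {X Y Z V : VField E M}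

/-- The vector field `V` is tangent to `D` near `x`. -/
def TangentAt (D : PlaneField E M) (V : VField E M) (x : M) : Prop :=
  ∀ᶠ y in 𝓝 x, V y ∈ D y

lemma TangentAt.eventually (h : TangentAt D V x) : ∀ᶠ y in 𝓝 x, TangentAt D V y :=
  h.eventually_nhds

variable [IsManifold 𝓘(ℝ, E) ∞ M]

lemma exists_section (hD : IsSmoothDistribution D) {v : TangentSpace 𝓘(ℝ, E) x} (hv : v ∈ D x) :
    ∃ V : VField E M, SmoothAt V x ∧ TangentAt D V x ∧ V x = v := by
  obtain ⟨u, k, X, hu, hxu, hX, hspan⟩ := hD x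
  rw [← (hspan x hxu).2, Submodule.mem_span_range_iff_exists_fun] at hv
  obtain ⟨c, rfl⟩ := hv
  refine ⟨fun y => ∑ i, c i • X i y, SmoothAt.sum fun i _ =>
    SmoothAt.smul (smoothFnAt_const (c i)) ((hX i).smoothAt hu hxu), ?_, rfl⟩
  filter_upwards [hu.mem_nhds hxu] with y hy
  rw [← (hspan y hy).2]
  exact Submodule.sum_mem _ fun i _ => Submodule.smul_mem _ _ (Submodule.subset_span ⟨i, rfl⟩)

variable (g : Metric E M)

/-- `∇_X Y` is tangent to `D` at `x` for all fields `X`, `Y` tangent to `D` near `x`. -/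
def GeodesicAt (D : PlaneField E M) (x : M) : Prop :=
  ∀ X Y : VField E M, SmoothAt X x → SmoothAt Y x → TangentAt D X x → TangentAt D Y x →
    covDeriv g X Y x ∈ D x

variable {g} in
lemma IsTotallyGeodesicOn.geodesicAt {s : Set M} (h : IsTotallyGeodesicOn g D s) (hs : IsOpen s)
    (hx : x ∈ s) : GeodesicAt g D x := by
  intro X Y hX hY hXD hYD
  obtain ⟨u, hu, huo, hxu⟩ := eventually_nhds_iff.1
    ((hX.eventually.and hY.eventually).and ((hXD.and hYD).and (hs.mem_nhds hx)))
  exact h u X Y huo (fun y hy => (hu y hy).2.2) (smoothFieldOn_of_forall fun y hy => (hu y hy).1.1)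
    (smoothFieldOn_of_forall fun y hy => (hu y hy).1.2) (fun y hy => (hu y hy).2.1) x hxu

/-- Smoothness of the orthogonal projection onto a smooth distribution. -/
lemma exists_smoothAt_projection (hD : IsSmoothDistribution D) (hV : SmoothAt V x) :
    ∃ P : VField E M, SmoothAt P x ∧
      ∀ᶠ y in 𝓝 x, P y ∈ D y ∧ ∀ w ∈ D y, g.inner y (P y) w = g.inner y (V y) w := by
  obtain ⟨u, k, X, hu, hxu, hX, hspan⟩ := hD x
  have hXx : ∀ i, SmoothAt (X i) x := fun i => (hX i).smoothAt hu hxu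
  obtain ⟨P, hP, h⟩ := exists_smoothAt_inner_eq g hXx
    (by filter_upwards [hu.mem_nhds hxu] with y hy using (hspan y hy).1)
    fun i => SmoothFnAt.ip g hV (hXx i)
  refine ⟨P, hP, ?_⟩
  filter_upwards [h, hu.mem_nhds hxu] with y hy hyu
  rw [← (hspan y hyu).2]
  refine ⟨hy.1, fun w hw => ?_⟩
  induction hw using Submodule.span_induction with
  | mem z hz =>
    obtain ⟨i, rfl⟩ := hz
    exact hy.2 i
  | zero => simp
  | add a b _ _ ha hb => simp [ha, hb]
  | smul c a _ ha => simp [ha]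

variable {g} in
lemma eq_of_mem_of_inner_eq {K : Submodule ℝ (TangentSpace 𝓘(ℝ, E) x)}
    {a b : TangentSpace 𝓘(ℝ, E) x} (ha : a ∈ K) (hb : b ∈ K)
    (h : ∀ w ∈ K, g.inner x a w = g.inner x b w) : a = b := by
  by_contra hab
  refine (g.pos x (a - b) (sub_ne_zero.2 hab)).ne' ?_
  rw [map_sub (g.inner x), sub_apply, h _ (K.sub_mem ha hb), sub_self]

/-- Subtracting the projection to D from any smooth extension of v avoids building a frame of the
complement; v itself is unchanged, since its projection is zero. -/
lemma exists_section_orthField (hD : IsSmoothDistribution D) {v : TangentSpace 𝓘(ℝ, E) x}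
    (hv : v ∈ orthField g D x) :
    ∃ V : VField E M, SmoothAt V x ∧ TangentAt (orthField g D) V x ∧ V x = v := by
  obtain ⟨P, hP, h⟩ := exists_smoothAt_projection g hD (smoothAt_extendVec v)
  refine ⟨extendVec v - P, (smoothAt_extendVec v).sub hP, ?_, ?_⟩
  · filter_upwards [h] with y hy w hw
    rw [Pi.sub_apply, map_sub, sub_apply, hy.2 w hw, sub_self]
  · have h0 : P x = 0 := eq_of_mem_of_inner_eq (g := g) h.self_of_nhds.1 (D x).zero_mem
      fun w hw => by rw [h.self_of_nhds.2 w hw, extendVec_self, hv w hw]; simp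
    rw [Pi.sub_apply, h0, extendVec_self, sub_zero]

variable {g} in
lemma ip_eventuallyEq_zero (hX : TangentAt D X x) (hV : TangentAt (orthField g D) V x) :
    ip g X V =ᶠ[𝓝 x] fun _ => 0 := by
  filter_upwards [hX, hV] with y hXy hVy
  rw [ip, g.symm, hVy _ hXy]

/-- Tangency to a smooth distribution is a closed condition on smooth vector fields. -/
lemma mem_of_frequently_mem (g : Metric E M) (hD : IsSmoothDistribution D) (hV : SmoothAt V x)
    (h : ∃ᶠ y in 𝓝 x, V y ∈ D y) : V x ∈ D x := by
  obtain ⟨P, hP, hPV⟩ := exists_smoothAt_projection g hD hV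
  -- The squared length of the normal part V - P is continuous and vanishes exactly where V is in D,
  -- so a nonzero value at x would exclude D on a neighbourhood.
  have hsm := SmoothFnAt.ip g (hV.sub hP) (hV.sub hP)
  have h0 : ip g (V - P) (V - P) x = 0 := by
    by_contra hne
    refine h ?_
    filter_upwards [hsm.contMDiffAt.continuousAt.eventually_ne hne, hPV] with y hy hPy hVy
    refine hy ?_
    have : P y = V y := eq_of_mem_of_inner_eq (g := g) hPy.1 hVy hPy.2
    simp [ip, this]
  have h1 : V x - P x = 0 := by
    by_contra hne
    exact (g.pos x _ hne).ne' h0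
  rw [sub_eq_zero.1 h1]
  exact hPV.self_of_nhds.1

variable [FiniteDimensional ℝ E]

variable {g}

/-- If `D` and its orthogonal complement are totally geodesic, then `D` is parallel. -/
lemma covDeriv_mem_of_geodesicAt (hD : IsSmoothDistribution D) (hx : GeodesicAt g D x)
    (hx' : GeodesicAt g (orthField g D) x) (hZ : SmoothAt Z x) (hY : SmoothAt Y x)
    (hYD : TangentAt D Y x) : covDeriv g Z Y x ∈ D x := by
  obtain ⟨z, hz, hzZ⟩ := exists_mem_inner_eq g (D x) (Z x)
  obtain ⟨V₁, hV₁, hV₁D, hV₁z⟩ := exists_section hD hz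
  obtain ⟨V₂, hV₂, hV₂D, hV₂z⟩ := exists_section_orthField g hD (v := Z x - z) fun w hw => by
    rw [map_sub, sub_apply, hzZ w hw, sub_self]
  rw [covDeriv_congr_left g hZ.mdiff (hV₁.add hV₂).mdiff hY.mdiff (by simp [hV₁z, hV₂z]),
    covDeriv_add_left g hV₁.mdiff hV₂.mdiff hY.mdiff]
  -- The D-part of Z is covered by total geodesy of D. For the normal part, differentiating g(Y,U) =
  -- 0 along `V₂` moves the derivative to U, where total geodesy of the complement applies.
  refine (D x).add_mem (hx V₁ Y hV₁ hY hV₁D hYD) (mem_of_inner_eq_zero g fun u hu => ?_)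
  obtain ⟨U, hU, hUD, rfl⟩ := exists_section_orthField g hD hu
  have h := dirDeriv_ip g hV₂.mdiff hY.mdiff hU.mdiff
  rw [dirDeriv_congr (ip_eventuallyEq_zero hYD hUD), dirDeriv_const, g.symm x (Y x),
    hx' V₂ U hV₂ hU hV₂D hUD _ hYD.self_of_nhds, add_zero] at h
  exact h.symm

lemma curvature_mem (hpar : ∀ y (Z Y : VField E M), SmoothAt Z y → SmoothAt Y y →
      TangentAt D Y y → covDeriv g Z Y y ∈ D y)
    (hZ : SmoothAt Z x) (hX : SmoothAt X x) (hY : SmoothAt Y x) (hYD : TangentAt D Y x) :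
    curvature g Z X Y x ∈ D x := by
  have key : ∀ V : VField E M, SmoothAt V x → TangentAt D (covDeriv g V Y) x := by
    intro V hV
    filter_upwards [hV.eventually, hY.eventually, hYD.eventually] with y h₁ h₂ h₃
    exact hpar y V Y h₁ h₂ h₃
  exact (D x).sub_mem ((D x).sub_mem (hpar x Z _ hZ (hX.covDeriv g hY) (key X hX))
    (hpar x X _ hX (hZ.covDeriv g hY) (key Z hZ))) (hpar x _ Y (hZ.bracket hX) hY hYD)

end Distributions

/-! ### Total geodesy of the range distribution -/

section TotallyGeodesicMap

variable {EM : Type*} [NormedAddCommGroup EM] [NormedSpace ℝ EM] [FiniteDimensional ℝ EM]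
  {M : Type*} [TopologicalSpace M] [ChartedSpace EM M] [IsManifold 𝓘(ℝ, EM) ∞ M]
  {EN : Type*} [NormedAddCommGroup EN] [NormedSpace ℝ EN] [FiniteDimensional ℝ EN]
  {N : Type*} [TopologicalSpace N] [ChartedSpace EN N] [IsManifold 𝓘(ℝ, EN) ∞ N]
  {gM : Metric EM M} {gN : Metric EN N} {F : M → N} {D : PlaneField EN N}

/-- The range of a totally geodesic Riemannian map is totally geodesic at the points of the
image. -/
lemma geodesicAt_of_map (hF : IsRiemannianMap gM gN F) (hFgeod : IsTotallyGeodesicMap gM gN F)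
    (hD : ∀ p : M, D (F p) = LinearMap.range (mfderiv 𝓘(ℝ, EM) 𝓘(ℝ, EN) F p).toLinearMap)
    (p : M) : GeodesicAt gN D (F p) := by
  intro X Y hX hY hXD hYD
  have hcont := hF.1.continuous.continuousAt (x := p)
  -- With lifts U of X and W of Y, the equation (∇F_*)(U,W) = 0 reads ∇_X Y = F_*(∇_U W) at F p,
  -- which lies in the range.
  obtain ⟨U, hU, hUX⟩ := exists_lift gM gN hF hX
    ((hcont.eventually hXD).mono fun q hq => hD q ▸ hq)
  obtain ⟨W, hW, hWY⟩ := exists_lift gM gN hF hY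
    ((hcont.eventually hYD).mono fun q hq => hD q ▸ hq)
  obtain ⟨u, hu, huo, hpu⟩ := eventually_nhds_iff.1 (hU.eventually.and hW.eventually)
  have h := hFgeod u U W huo (smoothFieldOn_of_forall fun y hy => (hu y hy).1)
    (smoothFieldOn_of_forall fun y hy => (hu y hy).2) p hpu
  rw [secondFundamentalForm, pullbackCovDeriv_eq gN (hF.1.contMDiffAt.mdifferentiableAt (by simp))
    hX.mdiff hY.mdiff hUX.self_of_nhds hWY, sub_eq_zero] at h
  rw [h, hD]
  exact ⟨_, rfl⟩

/-- Image points accumulate at every point of the closure, and membership of the smooth field ∇_X Y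
in D passes to the limit; the open complement of the closure is covered by `hDoff`. -/
lemma geodesicAt_of_isRangeDistribution (hF : IsRiemannianMap gM gN F)
    (hFgeod : IsTotallyGeodesicMap gM gN F) (hD : IsRangeDistribution (EM := EM) F D)
    (hDoff : IsTotallyGeodesicOn gN D (closure (range F))ᶜ) (y : N) : GeodesicAt gN D y := by
  by_cases hy : y ∈ closure (range F)
  · intro X Y hX hY hXD hYD
    refine mem_of_frequently_mem gN hD.1 (hX.covDeriv gN hY) ?_
    have hfr : ∃ᶠ z in 𝓝 y, z ∈ range F := mem_closure_iff_frequently.1 hy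
    refine (hfr.and_eventually ((hX.eventually.and hY.eventually).and
      (hXD.eventually.and hYD.eventually))).mono ?_
    rintro _ ⟨⟨p, rfl⟩, ⟨h₁, h₂⟩, h₃, h₄⟩
    exact geodesicAt_of_map hF hFgeod hD.2 p X Y h₁ h₂ h₃ h₄
  · exact hDoff.geodesicAt isClosed_closure.isOpen_compl hy

end TotallyGeodesicMap

/-- The trace of an endomorphism with image in the range of an injective map equals the trace of
the induced endomorphism. -/
lemma trace_eq_of_intertwine {V W : Type*} [AddCommGroup V] [Module ℝ V] [FiniteDimensional ℝ V]
    [AddCommGroup W] [Module ℝ W] [FiniteDimensional ℝ W] {j : V →ₗ[ℝ] W}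
    (hj : Function.Injective j) {A : V →ₗ[ℝ] V} {B : W →ₗ[ℝ] W} (h : ∀ v, j (A v) = B (j v))
    (hB : ∀ w, B w ∈ LinearMap.range j) : LinearMap.trace ℝ V A = LinearMap.trace ℝ W B := by
  let C : W →ₗ[ℝ] V := (LinearEquiv.ofInjective j hj).symm.toLinearMap ∘ₗ
    B.codRestrict (LinearMap.range j) hB
  have hC : ∀ w, j (C w) = B w := fun w => by
    have := (LinearEquiv.ofInjective j hj).apply_symm_apply (B.codRestrict _ hB w)
    exact congr(($this : W))
  have h₁ : B = j ∘ₗ C := LinearMap.ext fun w => (hC w).symm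
  have h₂ : A = C ∘ₗ j := LinearMap.ext fun v => hj ((h v).trans (hC _).symm)
  rw [h₁, h₂]
  exact LinearMap.trace_comp_comm' _ _

/-! ### Comparing an integral manifold with the ambient manifold -/

section IntegralManifold

variable {EL : Type*} [NormedAddCommGroup EL] [NormedSpace ℝ EL]
  {L : Type*} [TopologicalSpace L] [ChartedSpace EL L] [IsManifold 𝓘(ℝ, EL) ∞ L]
  {EN : Type*} [NormedAddCommGroup EN] [NormedSpace ℝ EN]
  {N : Type*} [TopologicalSpace N] [ChartedSpace EN N] [IsManifold 𝓘(ℝ, EN) ∞ N]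
  {gL : Metric EL L} {gN : Metric EN N} {ι : L → N} {D : PlaneField EN N} {p : L}
  {X Y Z : VField EL L} {X' Y' Z' : VField EN N}

variable (gL gN D) in
/-- `X` and `X'` are smooth `ι`-related fields near `p` and `ι p`, with `X'` tangent to `D`. -/
structure TangentPair (ι : L → N) (X : VField EL L) (X' : VField EN N) (p : L) : Prop where
  left : SmoothAt X p
  right : SmoothAt X' (ι p)
  tangent : TangentAt D X' (ι p)
  related : RelatedAt ι X X' p

variable (hι : IsIntegralManifold gL gN ι D)
include hι

/-- It allows `exists_lift` to be reused, to pull ambient fields tangent to D back to L. -/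
lemma IsIntegralManifold.isRiemannianMap : IsRiemannianMap gL gN ι :=
  ⟨hι.1, fun p v w _ _ => ((hι.2 p).2.2 v w).symm⟩

lemma TangentPair.eventually (h : TangentPair D ι X X' p) :
    ∀ᶠ q in 𝓝 p, TangentPair D ι X X' q := by
  have hc := hι.1.continuous.continuousAt (x := p)
  filter_upwards [h.left.eventually, hc.eventually h.right.eventually,
    hc.eventually h.tangent.eventually, h.related.eventually] with q h₁ h₂ h₃ h₄
  exact ⟨h₁, h₂, h₃, h₄⟩

variable [FiniteDimensional ℝ EL]

lemma IsIntegralManifold.exists_tangentPair_right (hX' : SmoothAt X' (ι p))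
    (hX'D : TangentAt D X' (ι p)) : ∃ X : VField EL L, TangentPair D ι X X' p := by
  obtain ⟨X, hX, hXX'⟩ := exists_lift gL gN hι.isRiemannianMap hX'
    ((hι.1.continuous.continuousAt.eventually hX'D).mono fun q hq => (hι.2 q).2.1 ▸ hq)
  exact ⟨X, hX, hX', hX'D, hXX'⟩

lemma IsIntegralManifold.exists_tangentPair (hD : IsSmoothDistribution D)
    (v : TangentSpace 𝓘(ℝ, EL) p) :
    ∃ (X : VField EL L) (X' : VField EN N), TangentPair D ι X X' p ∧ X p = v := by
  obtain ⟨X', hX', hX'D, hv⟩ := exists_section hD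
    (v := mfderiv 𝓘(ℝ, EL) 𝓘(ℝ, EN) ι p v) ((hι.2 p).2.1 ▸ ⟨v, rfl⟩)
  obtain ⟨X, hX⟩ := hι.exists_tangentPair_right hX' hX'D
  exact ⟨X, X', hX, (hι.2 p).1 (hX.related.self_of_nhds.trans hv)⟩

variable [FiniteDimensional ℝ EN] (hgeo : ∀ y, GeodesicAt gN D y)
include hgeo

/-- A totally geodesic distribution is involutive, since [X',Y'] = ∇_X' Y' - ∇_Y' X' by vanishing
torsion. -/
lemma TangentPair.bracket (hX : TangentPair D ι X X' p) (hY : TangentPair D ι Y Y' p) :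
    TangentPair D ι (bracket X Y) (bracket X' Y') p where
  left := hX.left.bracket hY.left
  right := hX.right.bracket hY.right
  tangent := by
    filter_upwards [hX.right.eventually, hX.tangent.eventually, hY.right.eventually,
      hY.tangent.eventually] with y h₁ h₂ h₃ h₄
    rw [← covDeriv_sub_swap gN h₁.mdiff h₃.mdiff]
    exact (D y).sub_mem (hgeo y X' Y' h₁ h₃ h₂ h₄) (hgeo y Y' X' h₃ h₁ h₄ h₂)
  related := RelatedAt.bracket hι.1 hX.left hX.right hY.left hY.right hX.related hY.related

variable (hD : IsSmoothDistribution D)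
include hD

/-- The second fundamental form of L in N vanishes. Because the derivative is again a tangent pair,
the operation can be iterated, as the curvature requires. -/
lemma TangentPair.covDeriv (hX : TangentPair D ι X X' p) (hY : TangentPair D ι Y Y' p) :
    TangentPair D ι (covDeriv gL X Y) (covDeriv gN X' Y') p where
  left := hX.left.covDeriv gL hY.left
  right := hX.right.covDeriv gN hY.right
  tangent := by
    filter_upwards [hX.right.eventually, hX.tangent.eventually, hY.right.eventually,
      hY.tangent.eventually] with y h₁ h₂ h₃ h₄ using hgeo y X' Y' h₁ h₃ h₂ h₄
  related := by
    filter_upwards [hX.eventually hι, hY.eventually hι] with q hX hY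
    have hmem := hgeo (ι q) X' Y' hX.right hY.right hX.tangent hY.tangent
    rw [← (hι.2 q).2.1] at hmem
    obtain ⟨a, ha⟩ := hmem
    refine mfderiv_covDeriv gL gN hι.1 (fun q v w => (hι.2 q).2.2 v w) hX.left hX.right hY.left
      hY.right hX.related hY.related (fun w => ?_) ha
    obtain ⟨Z, Z', hZ, hZw⟩ := hι.exists_tangentPair hD w
    exact ⟨Z, Z', hZ.left, hZ.right, hZ.related, hZw⟩

lemma TangentPair.mfderiv_curvature (hX : TangentPair D ι X X' p) (hY : TangentPair D ι Y Y' p)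
    (hZ : TangentPair D ι Z Z' p) :
    mfderiv 𝓘(ℝ, EL) 𝓘(ℝ, EN) ι p (curvature gL X Y Z p) = curvature gN X' Y' Z' (ι p) := by
  have h₁ := (hX.covDeriv hι hgeo hD (hY.covDeriv hι hgeo hD hZ)).related.self_of_nhds
  have h₂ := (hY.covDeriv hι hgeo hD (hX.covDeriv hι hgeo hD hZ)).related.self_of_nhds
  have h₃ := ((hX.bracket hι hgeo hY).covDeriv hι hgeo hD hZ).related.self_of_nhds
  simp only [curvature, map_sub, h₁, h₂, h₃]

/-- The ambient endomorphism Z ↦ R(Z,X')Y' restricts to that of L on tangent vectors, and since D is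
parallel its whole image lies in D. Normal directions thus contribute nothing to its trace. -/
lemma TangentPair.ricci_eq (hgeo' : ∀ y, GeodesicAt gN (orthField gN D) y)
    (hX : TangentPair D ι X X' p) (hY : TangentPair D ι Y Y' p) :
    ricci gL X Y p = ricci gN X' Y' (ι p) := by
  rw [ricci_eq_trace gL hX.left hY.left, ricci_eq_trace gN hX.right hY.right]
  refine trace_eq_of_intertwine (j := (mfderiv 𝓘(ℝ, EL) 𝓘(ℝ, EN) ι p).toLinearMap) (hι.2 p).1
    (fun v => ?_) fun w => ?_
  · obtain ⟨Z, Z', hZ, rfl⟩ := hι.exists_tangentPair hD v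
    rw [curvatureEnd_apply gL hX.left hY.left hZ.left]
    refine (hZ.mfderiv_curvature hι hgeo hD hX hY).trans ?_
    rw [← curvatureEnd_apply gN hX.right hY.right hZ.right, ← hZ.related.self_of_nhds]
    rfl
  · rw [(hι.2 p).2.1]
    exact curvature_mem (fun y Z Y hZ hY hYD => covDeriv_mem_of_geodesicAt hD (hgeo y) (hgeo' y)
      hZ hY hYD) (smoothAt_extendVec w) hX.right hY.right hY.tangent

lemma TangentPair.lieDerivMetric_eq {η : VField EL L} {ξ : VField EN N}
    (hη : TangentPair D ι η ξ p) (hX : TangentPair D ι X X' p) (hY : TangentPair D ι Y Y' p) :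
    lieDerivMetric gL η X Y p = lieDerivMetric gN ξ X' Y' (ι p) := by
  rw [RiemGeom.lieDerivMetric_eq gL hη.left hX.left hY.left,
    RiemGeom.lieDerivMetric_eq gN hη.right hX.right hY.right, (hι.2 p).2.2, (hι.2 p).2.2,
    (hX.covDeriv hι hgeo hD hη).related.self_of_nhds,
    (hY.covDeriv hι hgeo hD hη).related.self_of_nhds, hX.related.self_of_nhds,
    hY.related.self_of_nhds]

end IntegralManifold

/-! ### The soliton equation on the distribution -/

section Soliton

variable {E : Type*} [NormedAddCommGroup E] [NormedSpace ℝ E] [FiniteDimensional ℝ E]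
  {M : Type*} [TopologicalSpace M] [ChartedSpace E M] [IsManifold 𝓘(ℝ, E) ∞ M]
  {g : Metric E M} {D : PlaneField E M} {x : M} {X Y ξ : VField E M} {lam : ℝ}

lemma IsRicciSoliton.eq_zero (h : IsRicciSoliton g ξ lam) (hX : SmoothAt X x)
    (hY : SmoothAt Y x) :
    (1 / 2 : ℝ) * lieDerivMetric g ξ X Y x + ricci g X Y x + lam * ip g X Y x = 0 := by
  obtain ⟨u, hu, huo, hxu⟩ := eventually_nhds_iff.1 (hX.eventually.and hY.eventually)
  exact h.2 u X Y huo (smoothFieldOn_of_forall fun y hy => (hu y hy).1)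
    (smoothFieldOn_of_forall fun y hy => (hu y hy).2) x hxu

/-- For a field orthogonal to a totally geodesic distribution, the Lie derivative of the metric
vanishes on the distribution. -/
lemma lieDerivMetric_eq_zero (hgeo : GeodesicAt g D x) (hξ : SmoothAt ξ x)
    (hξD : ∀ y, ξ y ∈ orthField g D y) (hX : SmoothAt X x) (hY : SmoothAt Y x)
    (hXD : TangentAt D X x) (hYD : TangentAt D Y x) : lieDerivMetric g ξ X Y x = 0 := by
  have key : ∀ {V W : VField E M}, SmoothAt V x → SmoothAt W x → TangentAt D V x →
      TangentAt D W x → g.inner x (W x) (covDeriv g V ξ x) = 0 := by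
    intro V W hV hW hVD hWD
    -- Differentiate g(W,ξ) = 0 along V; the term g(∇_V W, ξ) vanishes because ∇_V W is in D.
    have h := dirDeriv_ip g hV.mdiff hW.mdiff hξ.mdiff
    rw [dirDeriv_congr (ip_eventuallyEq_zero hWD (.of_forall hξD)), dirDeriv_const,
      g.symm x _ (ξ x),
      hξD x _ (hgeo V W hV hW hVD hWD), zero_add] at h
    exact h.symm
  rw [lieDerivMetric_eq g hξ hX hY, g.symm, key hX hY hXD hYD, key hY hX hYD hXD, add_zero]

end Soliton

end RiemGeom

theorem theorem4p2
    {EM : Type*} [NormedAddCommGroup EM] [NormedSpace ℝ EM] [FiniteDimensional ℝ EM]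
    {M : Type*} [TopologicalSpace M] [ChartedSpace EM M] [IsManifold 𝓘(ℝ, EM) ∞ M]
    {EN : Type*} [NormedAddCommGroup EN] [NormedSpace ℝ EN] [FiniteDimensional ℝ EN]
    {N : Type*} [TopologicalSpace N] [ChartedSpace EN N] [IsManifold 𝓘(ℝ, EN) ∞ N]
    (gM : RiemGeom.Metric EM M) (gN : RiemGeom.Metric EN N)
    (F : M → N)
    (hF : RiemGeom.IsRiemannianMap gM gN F)
    (hFgeod : RiemGeom.IsTotallyGeodesicMap gM gN F)
    -- `D` is the distribution `range F_*` on `N`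
    (D : RiemGeom.PlaneField EN N)
    (hD : RiemGeom.IsRangeDistribution (EM := EM) F D)
    -- away from the closure of `F(M)`, where `F` carries no information, `D` is totally geodesic
    -- (no condition at all if `F(M)` is dense in `N`)
    (hDoff : RiemGeom.IsTotallyGeodesicOn gN D (closure (Set.range F))ᶜ)
    (hperp : RiemGeom.IsTotallyGeodesicOn gN (RiemGeom.orthField gN D) Set.univ)
    (ξ : RiemGeom.VField EN N) (lam : ℝ)
    (hsol : RiemGeom.IsRicciSoliton gN ξ lam) :
    ((∀ y, ξ y ∈ D y) →
      ∀ {EL : Type*} [NormedAddCommGroup EL] [NormedSpace ℝ EL] [FiniteDimensional ℝ EL]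
        {L : Type*} [TopologicalSpace L] [ChartedSpace EL L] [IsManifold 𝓘(ℝ, EL) ∞ L]
        (gL : RiemGeom.Metric EL L) (ι : L → N), RiemGeom.IsIntegralManifold gL gN ι D →
        ∃ η : RiemGeom.VField EL L,
          (∀ l, mfderiv 𝓘(ℝ, EL) 𝓘(ℝ, EN) ι l (η l) = ξ (ι l)) ∧
          RiemGeom.IsRicciSoliton gL η lam) ∧
    ((∀ y, ξ y ∈ RiemGeom.orthField gN D y) →
      ∀ {EL : Type*} [NormedAddCommGroup EL] [NormedSpace ℝ EL] [FiniteDimensional ℝ EL]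
        {L : Type*} [TopologicalSpace L] [ChartedSpace EL L] [IsManifold 𝓘(ℝ, EL) ∞ L]
        (gL : RiemGeom.Metric EL L) (ι : L → N), RiemGeom.IsIntegralManifold gL gN ι D →
        RiemGeom.IsEinstein gL (-lam)) := by
  have hgeo := RiemGeom.geodesicAt_of_isRangeDistribution hF hFgeod hD hDoff
  have hgeo' : ∀ y, RiemGeom.GeodesicAt gN (RiemGeom.orthField gN D) y :=
    fun y => hperp.geodesicAt isOpen_univ (mem_univ y)
  have hξ : ∀ y, RiemGeom.SmoothAt ξ y := fun y => hsol.1.smoothAt isOpen_univ (mem_univ y)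
  refine ⟨fun hξD => ?_, fun hξD => ?_⟩
  · intro EL _ _ _ L _ _ _ gL ι hι
    have hmem : ∀ l, ∃ v, mfderiv 𝓘(ℝ, EL) 𝓘(ℝ, EN) ι l v = ξ (ι l) := fun l => by
      have h := hξD (ι l)
      rwa [← (hι.2 l).2.1] at h
    choose η hη using hmem
    have hηs : ∀ l, RiemGeom.TangentPair D ι η ξ l := fun l => by
      obtain ⟨V, hV⟩ := hι.exists_tangentPair_right (hξ (ι l)) (.of_forall hξD)
      refine ⟨hV.left.congr ?_, hV.right, hV.tangent, .of_forall hη⟩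
      -- The pointwise choice η is smooth because injectivity of the differential makes it equal to
      -- the smooth local lift V.
      filter_upwards [hV.related] with q hq using (hι.2 q).1 ((hη q).trans hq.symm)
    refine ⟨η, hη, RiemGeom.smoothFieldOn_of_forall fun l _ => (hηs l).left, ?_⟩
    intro u X Y hu hX hY x hxu
    have hXx := hX.smoothAt hu hxu
    have hYx := hY.smoothAt hu hxu
    -- Every term of the equation depends only on the values of X and Y at x, so both may be
    -- replaced by fields V, W that are related to ambient fields tangent to D.
    obtain ⟨V, V', hV, hVX⟩ := hι.exists_tangentPair hD.1 (X x)
    obtain ⟨W, W', hW, hWY⟩ := hι.exists_tangentPair hD.1 (Y x)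
    have hip : RiemGeom.ip gL X Y x = RiemGeom.ip gN V' W' (ι x) := by
      simp only [RiemGeom.ip]
      rw [← hVX, ← hWY, (hι.2 x).2.2, hV.related.self_of_nhds, hW.related.self_of_nhds]
    have hlie : RiemGeom.lieDerivMetric gL η X Y x = RiemGeom.lieDerivMetric gL η V W x := by
      have hηx := (hηs x).left
      -- Rewriting the Lie derivative with ∇η removes all derivatives of X and Y, which shows the
      -- pointwise dependence.
      rw [RiemGeom.lieDerivMetric_eq gL hηx hXx hYx,
        RiemGeom.lieDerivMetric_eq gL hηx hV.left hW.left, hVX, hWY,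
        RiemGeom.covDeriv_congr_left gL hV.left.mdiff hXx.mdiff hηx.mdiff hVX,
        RiemGeom.covDeriv_congr_left gL hW.left.mdiff hYx.mdiff hηx.mdiff hWY]
    rw [hip, hlie, RiemGeom.TangentPair.lieDerivMetric_eq hι hgeo hD.1 (hηs x) hV hW,
      RiemGeom.ricci_eq_of_eq gL hXx hV.left hYx hW.left hVX.symm hWY.symm,
      hV.ricci_eq hι hgeo hD.1 hgeo' hW]
    exact hsol.eq_zero hV.right hW.right
  · intro EL _ _ _ L _ _ _ gL ι hι u X Y hu hX hY x hxu
    have hXx := hX.smoothAt hu hxu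
    have hYx := hY.smoothAt hu hxu
    obtain ⟨V, V', hV, hVX⟩ := hι.exists_tangentPair hD.1 (X x)
    obtain ⟨W, W', hW, hWY⟩ := hι.exists_tangentPair hD.1 (Y x)
    have hip : RiemGeom.ip gL X Y x = RiemGeom.ip gN V' W' (ι x) := by
      simp only [RiemGeom.ip]
      rw [← hVX, ← hWY, (hι.2 x).2.2, hV.related.self_of_nhds, hW.related.self_of_nhds]
    have h := hsol.eq_zero hV.right hW.right
    rw [RiemGeom.lieDerivMetric_eq_zero (hgeo _) (hξ _) hξD hV.right hW.right hV.tangent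
      hW.tangent] at h
    rw [hip, RiemGeom.ricci_eq_of_eq gL hXx hV.left hYx hW.left hVX.symm hWY.symm,
      hV.ricci_eq hι hgeo hD.1 hgeo' hW]
    linarith
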